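/- Let $\Bbbk$ be a field of characteristic zero and let $W_+$ be the positive Witt algebra: the Lie algebra over $\Bbbk$ with basis $e_i$ ($i\ge 1$) and bracket $[e_i,e_j]=(j-i)e_{i+j}$. Let $\mathrm{U}(W_+)$ be its enveloping algebra and $\mathrm{S}(W_+)=\Bbbk[x_1,x_2,\dots]$ its symmetric algebra ($x_i$ being the image of $e_i$), with the Poisson bracket determined by $\{x_i,x_j\}=(j-i)x_{i+j}$. *Gradings, filtrations and associated graded ideals.* $\mathrm{U}(W_+)$ is graded by degree, $d(e_i)=i$; for an ideal $J$, $\operatorname{gr}_d(J)\triangleleft \mathrm{U}(W_+)$ is the ideal spanned by the $d$-homogeneous components of highest degree of the elements of $J$. For weights $w(e_i)\in\mathbb N$, filter $\mathrm{U}(W_+)$ by letting the $n$-th piece be the span of the products $e_{i_1}\cdots e_{i_r}$ with $\sum_j w(e_{i_j})\le n$. With $w(e_i)=1$ this is the order filtration $o$, with $w(e_i)=i+1$ it is the degree-order filtration $do$; in both cases the associated graded algebra is $\mathrm{S}(W_+)$ (by the Poincaré–Birkhoff–Witt theorem), and for an ideal $I$ of $\mathrm{U}(W_+)$ we write $\operatorname{gr}_o(I)$,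 $\operatorname{gr}_{do}(I)\triangleleft \mathrm{S}(W_+)$ for the ideals spanned by the leading symbols of the elements of $I$. The ideal $\operatorname{gr}_o(I)$ is a Poisson ideal if $I$ is two-sided. *Dimensions.* For $f:\mathbb N\to\mathbb N$ let $\gamma(f)\in[0,\infty]$ be the infimum of the real $\gamma\ge 0$ such that, for some $c,m\in\mathbb N$, $f(n)\le c(mn)^\gamma$ for all but finitely many $n$. For a $\Bbbk$-algebra $R$, $\operatorname{GK} R=\sup_V\gamma\big(n\mapsto\dim\sum_{i=0}^n V^i\big)$, and for a (commutative) Poisson algebra $A$, $\operatorname{PGKdim} A=\sup_V\gamma\big(n\mapsto\dim\sum_{i=0}^n V^{\{i\}}\big)$, where $V^{\{0\}}=\Bbbk$ and $V^{\{n+1\}}=VV^{\{n\}}+\{V,V^{\{n\}}\}$; in both cases $V$ runs over the finite-dimensional subspaces. **Theorem.** Let $J$ be a two-sided ideal of $\mathrm{U}(W_+)$, let $I=\operatorname{gr}_d(J)$ and $K=\operatorname{gr}_o(I)$. Then $K=\operatorname{gr}_{do}(I)$ and $$\operatorname{GK}\,\mathrm{U}(W_+)/J=\operatorname{GK}\,\mathrm{U}(W_+)/I=\operatorname{PGKdim}\,\mathrm{S}(W_+)/K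 .$$ -/

import Mathlib

open scoped NNReal ENNReal

noncomputable section

/-! ### Growth of functions and Gelfand–Kirillov dimension -/

/-- `f ≤* g`: there are `c, m ∈ ℕ` with `f n ≤ c * g (m * n)` for all but finitely many `n`. -/
def GrowthLE (f g : ℕ → ℝ) : Prop :=
  ∃ c m : ℕ, ∀ᶠ n in Filter.atTop, f n ≤ c * g (m * n)

/-- `inf {γ ≥ 0 : 𝒢(f) ≤ 𝒢(n ↦ n ^ γ)} ∈ [0, ∞]`; the infimum of the empty set is `∞`. -/
def growthExponent (f : ℕ → ℕ) : ℝ≥0∞ :=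
  ⨅ (γ : ℝ≥0) (_ : GrowthLE (fun n => (f n : ℝ)) (fun n => (n : ℝ) ^ (γ : ℝ))), (γ : ℝ≥0∞)

/-- `d_V(n) = dim (∑_{i ≤ n} V ^ i)`. -/
def growthFun {k R : Type*} [Field k] [Ring R] [Algebra k R] (V : Submodule k R) (n : ℕ) : ℕ :=
  Module.finrank k (↥(⨆ i ∈ Finset.range (n + 1), V ^ i))

/-- The Gelfand–Kirillov dimension: the supremum, over all finite-dimensional subspaces `V`
(equivalently, over all finitely generated subalgebras `k⟨V⟩`), of the growth exponent of `d_V`. -/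
def GKdim (k R : Type*) [Field k] [Ring R] [Algebra k R] : ℝ≥0∞ :=
  ⨆ (V : Submodule k R) (_ : V.FG), growthExponent (growthFun V)

/-! ### Poisson algebras and Poisson Gelfand–Kirillov dimension -/

/-- A (commutative) Poisson algebra over `k`. -/
class PoissonAlgebra (k A : Type*) [Field k] [CommRing A] [Algebra k A] where
  /-- The Poisson bracket. -/
  pb : A →ₗ[k] A →ₗ[k] A
  pb_self : ∀ a, pb a a = 0
  pb_jacobi : ∀ a b c, pb a (pb b c) + pb b (pb c a) + pb c (pb a b) = 0
  pb_mul : ∀ a b c, pb a (b * c) = pb a b * c + b * pb a c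

/-- `V^{0} = k`, `V^{n+1} = V V^{n} + {V, V^{n}}`. -/
def poissonPow {k A : Type*} [Field k] [CommRing A] [Algebra k A] [PoissonAlgebra k A]
    (V : Submodule k A) : ℕ → Submodule k A
  | 0 => 1
  | n + 1 => V * poissonPow V n ⊔ Submodule.map₂ PoissonAlgebra.pb V (poissonPow V n)

/-- `pd_V(n) = dim (∑_{i ≤ n} V^{i})`. -/
def poissonGrowthFun {k A : Type*} [Field k] [CommRing A] [Algebra k A] [PoissonAlgebra k A]
    (V : Submodule k A) (n : ℕ) : ℕ :=
  Module.finrank k (↥(⨆ i ∈ Finset.range (n + 1), poissonPow V i))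

/-- The Poisson Gelfand–Kirillov dimension: the supremum, over all finite-dimensional subspaces `V`
(equivalently, over all finitely generated Poisson subalgebras), of the growth exponent
of `pd_V`. -/
def PGKdim (k A : Type*) [Field k] [CommRing A] [Algebra k A] [PoissonAlgebra k A] : ℝ≥0∞ :=
  ⨆ (V : Submodule k A) (_ : V.FG), growthExponent (poissonGrowthFun V)

/-- A Poisson ideal: an ideal `K` with `{A, K} ⊆ K`. -/
class IsPoissonIdeal (k : Type*) {A : Type*} [Field k] [CommRing A] [Algebra k A]
    [PoissonAlgebra k A] (K : Ideal A) : Prop where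
  pb_mem : ∀ (a : A) {b : A}, b ∈ K → PoissonAlgebra.pb (k := k) a b ∈ K

section Quotient

variable {k A : Type*} [Field k] [CommRing A] [Algebra k A] [PoissonAlgebra k A]

theorem PoissonAlgebra.pb_swap (a b : A) :
    PoissonAlgebra.pb (k := k) a b = -PoissonAlgebra.pb (k := k) b a := by
  have h := PoissonAlgebra.pb_self (k := k) (a + b)
  simp only [map_add, LinearMap.add_apply, PoissonAlgebra.pb_self, zero_add, add_zero] at h
  exact eq_neg_of_add_eq_zero_right h

/-- The induced bracket `{a + K, b + K} = {a, b} + K` on the quotient by a Poisson ideal. -/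
def quotientBracket (K : Ideal A) [hK : IsPoissonIdeal k K] (x y : A ⧸ K) : A ⧸ K :=
  Quotient.liftOn₂' x y (fun a b => Ideal.Quotient.mk K (PoissonAlgebra.pb (k := k) a b)) <| by
    intro a b a' b' ha hb
    rw [Submodule.quotientRel_def] at ha hb
    rw [Ideal.Quotient.eq]
    have h : PoissonAlgebra.pb (k := k) a b - PoissonAlgebra.pb (k := k) a' b'
        = -PoissonAlgebra.pb (k := k) b (a - a') + PoissonAlgebra.pb (k := k) a' (b - b') := by
      rw [← PoissonAlgebra.pb_swap]
      simp only [map_sub, LinearMap.sub_apply]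
      abel
    rw [h]
    exact K.add_mem (K.neg_mem (hK.pb_mem _ ha)) (hK.pb_mem _ hb)

theorem quotientBracket_mk (K : Ideal A) [IsPoissonIdeal k K] (a b : A) :
    quotientBracket (k := k) K (Ideal.Quotient.mk K a) (Ideal.Quotient.mk K b)
      = Ideal.Quotient.mk K (PoissonAlgebra.pb (k := k) a b) := rfl

/-- The quotient of a Poisson algebra by a Poisson ideal. -/
instance quotientPoissonAlgebra (K : Ideal A) [IsPoissonIdeal k K] :
    PoissonAlgebra k (A ⧸ K) where
  pb := LinearMap.mk₂ k (quotientBracket (k := k) K)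
    (by
      intro x x' y
      obtain ⟨a, rfl⟩ := Ideal.Quotient.mk_surjective x
      obtain ⟨a', rfl⟩ := Ideal.Quotient.mk_surjective x'
      obtain ⟨b, rfl⟩ := Ideal.Quotient.mk_surjective y
      rw [← map_add, quotientBracket_mk, map_add, LinearMap.add_apply, map_add]
      rfl)
    (by
      intro c x y
      obtain ⟨a, rfl⟩ := Ideal.Quotient.mk_surjective x
      obtain ⟨b, rfl⟩ := Ideal.Quotient.mk_surjective y
      change quotientBracket (k := k) K (Ideal.Quotient.mk K (c • a)) _ =
        Ideal.Quotient.mk K (c • _)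
      simp only [quotientBracket_mk, map_smul, LinearMap.smul_apply])
    (by
      intro x y y'
      obtain ⟨a, rfl⟩ := Ideal.Quotient.mk_surjective x
      obtain ⟨b, rfl⟩ := Ideal.Quotient.mk_surjective y
      obtain ⟨b', rfl⟩ := Ideal.Quotient.mk_surjective y'
      rw [← map_add, quotientBracket_mk, map_add, map_add]
      rfl)
    (by
      intro c x y
      obtain ⟨a, rfl⟩ := Ideal.Quotient.mk_surjective x
      obtain ⟨b, rfl⟩ := Ideal.Quotient.mk_surjective y
      change quotientBracket (k := k) K _ (Ideal.Quotient.mk K (c • b)) =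
        Ideal.Quotient.mk K (c • _)
      simp only [quotientBracket_mk, map_smul])
  pb_self x := by
    obtain ⟨a, rfl⟩ := Ideal.Quotient.mk_surjective x
    simp only [LinearMap.mk₂_apply, quotientBracket_mk, PoissonAlgebra.pb_self, map_zero]
  pb_jacobi x y z := by
    obtain ⟨a, rfl⟩ := Ideal.Quotient.mk_surjective x
    obtain ⟨b, rfl⟩ := Ideal.Quotient.mk_surjective y
    obtain ⟨c, rfl⟩ := Ideal.Quotient.mk_surjective z
    simp only [LinearMap.mk₂_apply, quotientBracket_mk]
    rw [← map_add, ← map_add, PoissonAlgebra.pb_jacobi, map_zero]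
  pb_mul x y z := by
    obtain ⟨a, rfl⟩ := Ideal.Quotient.mk_surjective x
    obtain ⟨b, rfl⟩ := Ideal.Quotient.mk_surjective y
    obtain ⟨c, rfl⟩ := Ideal.Quotient.mk_surjective z
    simp only [LinearMap.mk₂_apply]
    rw [← map_mul, quotientBracket_mk, PoissonAlgebra.pb_mul, map_add, map_mul, map_mul]
    rfl

end Quotient

/-! ### The positive Witt algebra -/

/-- The underlying vector space of the positive Witt algebra, with basis `e_i`, `i ≥ 1`. -/
def WittPos (k : Type*) [Field k] : Type _ := ℕ+ →₀ k

namespace WittPos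

variable (k : Type*) [Field k]

instance : AddCommGroup (WittPos k) := inferInstanceAs (AddCommGroup (ℕ+ →₀ k))

instance : Module k (WittPos k) := inferInstanceAs (Module k (ℕ+ →₀ k))

/-- The basis `(e_i)`, `i ≥ 1`. -/
def basis : Module.Basis ℕ+ k (WittPos k) :=
  Module.Basis.ofRepr (LinearEquiv.refl k (ℕ+ →₀ k))

/-- The basis vector `e_i`. -/
def e (i : ℕ+) : WittPos k := basis k i

/-- The bilinear map with `[e_i, e_j] = (j - i) e_{i+j}`. -/
def bracket : WittPos k →ₗ[k] WittPos k →ₗ[k] WittPos k :=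
  (basis k).constr k fun i => (basis k).constr k fun j => (((j : ℕ) : k) - ((i : ℕ) : k)) • e k (i + j)

theorem bracket_e (i j : ℕ+) :
    bracket k (e k i) (e k j) = (((j : ℕ) : k) - ((i : ℕ) : k)) • e k (i + j) := by
  simp [bracket, e]

theorem bracket_swap (x y : WittPos k) : bracket k x y = -bracket k y x := by
  have h : bracket k = -(bracket k).flip := by
    refine (basis k).ext fun i => (basis k).ext fun j => ?_
    change bracket k (e k i) (e k j) = -(bracket k (e k j) (e k i))
    rw [bracket_e, bracket_e, ← neg_smul, add_comm j i, neg_sub]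
  exact congrArg (fun f => f x y) h

theorem e_induction {P : WittPos k → Prop} (mem : ∀ i, P (e k i)) (zero : P 0)
    (add : ∀ x y, P x → P y → P (x + y)) (smul : ∀ (c : k) x, P x → P (c • x))
    (x : WittPos k) : P x := by
  have hx : x ∈ Submodule.span k (Set.range (basis k)) := (basis k).mem_span x
  induction hx using Submodule.span_induction with
  | mem y hy => obtain ⟨i, rfl⟩ := hy; exact mem i
  | zero => exact zero
  | add y z _ _ hy hz => exact add y z hy hz
  | smul c y _ hy => exact smul c y hy

theorem bracket_self (x : WittPos k) : bracket k x x = 0 := by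
  induction x using e_induction with
  | zero => simp
  | smul c x hx => simp [hx]
  | add x y hx hy => simp [hx, hy, bracket_swap k x y]
  | mem i => simp [bracket_e]

theorem bracket_leibniz (x y z : WittPos k) :
    bracket k x (bracket k y z) = bracket k (bracket k x y) z + bracket k y (bracket k x z) := by
  induction x using e_induction with
  | zero => simp
  | smul c x hx => simp [hx]
  | add x y hx hy => simp only [map_add, LinearMap.add_apply, hx, hy]; abel
  | mem i =>
  induction y using e_induction with
  | zero => simp
  | smul c x hx => simp [hx]
  | add x y hx hy => simp only [map_add, LinearMap.add_apply, hx, hy]; abel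
  | mem j =>
  induction z using e_induction with
  | zero => simp
  | smul c x hx => simp [hx]
  | add x y hx hy => simp only [map_add, hx, hy]; abel
  | mem l =>
  simp only [bracket_e, map_smul, LinearMap.smul_apply, smul_smul]
  rw [show i + j + l = i + (j + l) from add_assoc i j l,
    show j + (i + l) = i + (j + l) from add_left_comm j i l, ← add_smul]
  congr 1
  push_cast
  ring

/-- The Lie bracket of `W₊`. -/
instance : LieRing (WittPos k) where
  bracket x y := bracket k x y
  add_lie x y z := by simp
  lie_add x y z := by simp
  lie_self x := bracket_self k x
  leibniz_lie x y z := bracket_leibniz k x y z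

instance : LieAlgebra k (WittPos k) where
  lie_smul c x y := (bracket k x).map_smul c y

theorem lie_e (i j : ℕ+) :
    ⁅e k i, e k j⁆ = (((j : ℕ) : k) - ((i : ℕ) : k)) • e k (i + j) :=
  bracket_e k i j

end WittPos

/-! ### The symmetric algebra `S(W₊)` with its Poisson bracket -/

/-- The symmetric algebra `S(W₊)`. -/
abbrev SymW (k : Type*) [Field k] : Type _ := SymmetricAlgebra k (WittPos k)

namespace SymW

variable (k : Type*) [Field k]

/-- `x_i ∈ S(W₊)`, the image of `e_i`. -/
def x (i : ℕ+) : SymW k := SymmetricAlgebra.ι k (WittPos k) (WittPos.e k i)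

/-- The identification `S(W₊) = k[x_1, x_2, …]`. -/
def equivPoly : SymW k ≃ₐ[k] MvPolynomial ℕ+ k :=
  SymmetricAlgebra.equivMvPolynomial (WittPos.basis k)

/-- The derivation `{x_j, -}` of `k[x_1, x_2, …]`, with `{x_j, x_i} = (i - j) x_{i+j}`. -/
def ham (j : ℕ+) : Derivation k (MvPolynomial ℕ+ k) (MvPolynomial ℕ+ k) :=
  MvPolynomial.mkDerivation k fun i =>
    (((i : ℕ) : k) - ((j : ℕ) : k)) • MvPolynomial.X (i + j)

/-- The derivation `{f, -}` of `k[x_1, x_2, …]`, with `{f, x_j} = -{x_j, f}`. -/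
def hamP (f : MvPolynomial ℕ+ k) : Derivation k (MvPolynomial ℕ+ k) (MvPolynomial ℕ+ k) :=
  MvPolynomial.mkDerivation k fun j => -ham k j f

theorem hamP_X (f : MvPolynomial ℕ+ k) (j : ℕ+) : hamP k f (MvPolynomial.X j) = -ham k j f := by
  simp [hamP]

theorem hamP_X_X (i j : ℕ+) : hamP k (MvPolynomial.X i) (MvPolynomial.X j) =
    (((j : ℕ) : k) - ((i : ℕ) : k)) • MvPolynomial.X (i + j) := by
  rw [hamP_X, ham, MvPolynomial.mkDerivation_X, ← neg_smul, neg_sub]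

theorem hamP_add (f g : MvPolynomial ℕ+ k) : hamP k (f + g) = hamP k f + hamP k g := by
  refine MvPolynomial.derivation_ext fun j => ?_
  rw [Derivation.add_apply]
  simp only [hamP_X, map_add]
  ring

theorem hamP_smul (c : k) (f : MvPolynomial ℕ+ k) : hamP k (c • f) = c • hamP k f := by
  refine MvPolynomial.derivation_ext fun j => ?_
  rw [Derivation.smul_apply]
  rw [hamP_X, hamP_X, Derivation.map_smul, smul_neg]

theorem hamP_mul (f g : MvPolynomial ℕ+ k) : hamP k (f * g) = f • hamP k g + g • hamP k f := by
  refine MvPolynomial.derivation_ext fun j => ?_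
  rw [Derivation.add_apply, Derivation.smul_apply, Derivation.smul_apply]
  simp only [hamP_X, Derivation.leibniz, smul_eq_mul]
  ring

theorem hamP_C (c : k) : hamP k (MvPolynomial.C c) = 0 := by
  refine MvPolynomial.derivation_ext fun j => ?_
  simp only [hamP_X, MvPolynomial.derivation_C, neg_zero, Derivation.zero_apply]

theorem hamP_X_eq (i : ℕ+) : hamP k (MvPolynomial.X i) = ham k i := by
  refine MvPolynomial.derivation_ext fun j => ?_
  rw [hamP_X_X, ham, MvPolynomial.mkDerivation_X, add_comm]

theorem hamP_swap (f g : MvPolynomial ℕ+ k) : hamP k f g = -hamP k g f := by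
  induction g using MvPolynomial.induction_on with
  | C c => simp [hamP_C, MvPolynomial.derivation_C]
  | add p q hp hq => rw [map_add, hamP_add, Derivation.add_apply, hp, hq]; ring
  | mul_X p j hp =>
    rw [Derivation.leibniz, hamP_mul, Derivation.add_apply, Derivation.smul_apply,
      Derivation.smul_apply, hp, hamP_X, hamP_X_eq]
    simp only [smul_eq_mul]
    ring

theorem hamP_self (f : MvPolynomial ℕ+ k) : hamP k f f = 0 := by
  induction f using MvPolynomial.induction_on with
  | C c => simp [hamP_C]
  | add p q hp hq =>
    rw [map_add, hamP_add, Derivation.add_apply, Derivation.add_apply, hp, hq, hamP_swap k p q]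
    ring
  | mul_X p j hp =>
    rw [Derivation.leibniz, hamP_mul]
    simp only [Derivation.add_apply, Derivation.smul_apply, smul_eq_mul, hp]
    rw [hamP_X_X, sub_self, zero_smul, hamP_swap k p]
    ring

theorem hamP_jacobi (f g h : MvPolynomial ℕ+ k) :
    hamP k f (hamP k g h) = hamP k (hamP k f g) h + hamP k g (hamP k f h) := by
  have step : ∀ p q g h : MvPolynomial ℕ+ k,
      hamP k p (hamP k g h) = hamP k (hamP k p g) h + hamP k g (hamP k p h) →
      hamP k q (hamP k g h) = hamP k (hamP k q g) h + hamP k g (hamP k q h) →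
      hamP k (p * q) (hamP k g h)
        = hamP k (hamP k (p * q) g) h + hamP k g (hamP k (p * q) h) := by
    intro p q g h hp hq
    simp only [hamP_mul, hamP_add, Derivation.add_apply, Derivation.smul_apply, map_add,
      Derivation.leibniz, smul_eq_mul, hp, hq]
    rw [hamP_swap k g p, hamP_swap k g q]
    ring
  have hC : ∀ (c : k) (g h : MvPolynomial ℕ+ k), hamP k (MvPolynomial.C c) (hamP k g h)
      = hamP k (hamP k (MvPolynomial.C c) g) h + hamP k g (hamP k (MvPolynomial.C c) h) := by
    intro c g h
    have h0 : hamP k 0 = 0 := by simpa using hamP_C k 0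
    simp [hamP_C, h0]
  have flip : ∀ f g h : MvPolynomial ℕ+ k,
      hamP k f (hamP k g h) = hamP k (hamP k f g) h + hamP k g (hamP k f h) →
      hamP k g (hamP k f h) = hamP k (hamP k g f) h + hamP k f (hamP k g h) := by
    intro f g h H
    have hneg : hamP k (hamP k g f) h = -hamP k (hamP k f g) h := by
      rw [hamP_swap k g f, hamP_swap k (-_) h, map_neg, neg_neg, hamP_swap k h]
    rw [hneg, H]
    ring
  have hXX : ∀ (i j : ℕ+) (h : MvPolynomial ℕ+ k),
      hamP k (.X i) (hamP k (.X j) h)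
        = hamP k (hamP k (.X i) (.X j)) h + hamP k (.X j) (hamP k (.X i) h) := by
    intro i j h
    induction h using MvPolynomial.induction_on with
    | C c => simp [MvPolynomial.derivation_C]
    | add p q hp hq => simp only [map_add, hp, hq]; ring
    | mul_X p l hp =>
      have hl : hamP k (.X i) (hamP k (.X j) (.X l))
          = hamP k (hamP k (.X i) (.X j)) (.X l) + hamP k (.X j) (hamP k (.X i) (.X l)) := by
        simp only [hamP_X_X, hamP_smul, Derivation.smul_apply, Derivation.map_smul, smul_smul]
        rw [show i + j + l = i + (j + l) from add_assoc i j l,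
          show j + (i + l) = i + (j + l) from add_left_comm j i l, ← add_smul]
        congr 1
        push_cast
        ring
      simp only [Derivation.leibniz, map_add, smul_eq_mul, hp, hl]
      ring
  have hX : ∀ (i : ℕ+) (g h : MvPolynomial ℕ+ k),
      hamP k (.X i) (hamP k g h) = hamP k (hamP k (.X i) g) h + hamP k g (hamP k (.X i) h) := by
    intro i g h
    refine flip _ _ _ ?_
    induction g using MvPolynomial.induction_on with
    | C c => exact hC c _ _
    | add p q hp hq => simp only [hamP_add, Derivation.add_apply, map_add, hp, hq]; ring
    | mul_X p j hp => exact step _ _ _ _ hp (hXX j i h)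
  induction f using MvPolynomial.induction_on with
  | C c => exact hC c _ _
  | add p q hp hq => simp only [hamP_add, Derivation.add_apply, map_add, hp, hq]; ring
  | mul_X p i hp => exact step _ _ _ _ hp (hX i g h)

/-- The Poisson bracket on `S(W₊)`: the unique biderivation extending the Lie bracket,
`{f, g} = ∑_{i,j} (∂f/∂x_i) (∂g/∂x_j) (j - i) x_{i+j}`. -/
instance : PoissonAlgebra k (SymW k) where
  pb := LinearMap.mk₂ k
    (fun f g => (equivPoly k).symm (hamP k (equivPoly k f) (equivPoly k g)))
    (by intro f f' g; simp only [map_add, hamP_add, Derivation.add_apply])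
    (by intro c f g; simp only [map_smul, hamP_smul, Derivation.smul_apply])
    (by intro f g g'; simp only [map_add])
    (by intro c f g; rw [map_smul, Derivation.map_smul, map_smul])
  pb_self f := by simp only [LinearMap.mk₂_apply, hamP_self, map_zero]
  pb_jacobi f g h := by
    simp only [LinearMap.mk₂_apply, AlgEquiv.apply_symm_apply]
    rw [← map_add, ← map_add, hamP_jacobi, hamP_swap k (equivPoly k h) (hamP k _ _),
      hamP_swap k (equivPoly k h) (equivPoly k f), map_neg]
    simp
  pb_mul f g h := by
    simp only [LinearMap.mk₂_apply]
    rw [map_mul, Derivation.leibniz]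
    simp only [smul_eq_mul, map_add, map_mul, AlgEquiv.symm_apply_apply]
    ring

theorem pb_x (i j : ℕ+) : PoissonAlgebra.pb (k := k) (x k i) (x k j) =
    (((j : ℕ) : k) - ((i : ℕ) : k)) • x k (i + j) := by
  change (equivPoly k).symm (hamP k (equivPoly k (x k i)) (equivPoly k (x k j))) = _
  have h : ∀ i, equivPoly k (x k i) = MvPolynomial.X i :=
    fun i => SymmetricAlgebra.equivMvPolynomial_ι_apply (WittPos.basis k) i
  rw [h, h, hamP_X_X, map_smul, ← h, AlgEquiv.symm_apply_apply]

end SymW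

/-! ### The enveloping algebra, its filtrations, and associated graded ideals -/

/-- The universal enveloping algebra `U(W₊)`. -/
abbrev UW (k : Type*) [Field k] : Type _ := UniversalEnvelopingAlgebra k (WittPos k)

section Gr

variable (k : Type*) [Field k]

/-- `e_i` as an element of `U(W₊)`. -/
def UW.e (i : ℕ+) : UW k := UniversalEnvelopingAlgebra.ι k (WittPos.e k i)

/-- Given weights `w i` of the letters `i ≥ 1`, the span in the free algebra of all words
`i_1 i_2 ⋯ i_r` whose weight `w i_1 + ⋯ + w i_r` lies in `s`. -/
def wordSpan (w : ℕ+ → ℕ) (s : Set ℕ) : Submodule k (FreeAlgebra k ℕ+) :=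
  Submodule.span k
    ((fun l : List ℕ+ => (l.map (FreeAlgebra.ι k)).prod) '' {l | (l.map w).sum ∈ s})

/-- Evaluation `t ↦ t(e_1, e_2, …)` of noncommutative polynomials in `U(W₊)`. -/
def evalU : FreeAlgebra k ℕ+ →ₐ[k] UW k := FreeAlgebra.lift k (UW.e k)

/-- Evaluation `t ↦ t(x_1, x_2, …)` of noncommutative polynomials in `S(W₊)`. -/
def evalS : FreeAlgebra k ℕ+ →ₐ[k] SymW k := FreeAlgebra.lift k (SymW.x k)

/-- For the filtration of `U(W₊)` in which `e_i` has weight `w i`, the span of all products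
`e_{i_1} ⋯ e_{i_r}` of weight `< n`. -/
def filtLT (w : ℕ+ → ℕ) (n : ℕ) : Submodule k (UW k) :=
  (wordSpan k w (Set.Iio n)).map (evalU k).toLinearMap

variable {k}

/-- The associated graded space of `J ⊆ U(W₊)` for the filtration given by the weights `w`.
The algebra `B` is the associated graded algebra of `U(W₊)`, and for a noncommutative polynomial
`t`, homogeneous of weight `n`, `φ t ∈ B` is the class of `t(e_1, e_2, …)` in degree `n`.
Thus `gr J` is spanned by the leading terms of the elements `f ∈ J`: if
`f = t(e_1, e_2, …) + (terms of weight < n)` then `φ t` is the degree `n` leading term of `f`.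
(For `B = S(W₊)` this is well defined, and is the usual principal symbol, by the
Poincaré–Birkhoff–Witt theorem.) -/
def grSpan (w : ℕ+ → ℕ) {B : Type*} [Ring B] [Algebra k B] (φ : FreeAlgebra k ℕ+ →ₐ[k] B)
    (J : Ideal (UW k)) : Submodule k B :=
  Submodule.span k
    {b | ∃ n, ∃ t ∈ wordSpan k w {n}, φ t = b ∧ ∃ f ∈ J, f - evalU k t ∈ filtLT k w n}

theorem wordSpan_mul_left (w : ℕ+ → ℕ) {s s' : Set ℕ} (j : ℕ+) (h : ∀ a ∈ s, w j + a ∈ s')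
    {t : FreeAlgebra k ℕ+} (ht : t ∈ wordSpan k w s) :
    FreeAlgebra.ι k j * t ∈ wordSpan k w s' := by
  induction ht using Submodule.span_induction with
  | mem y hy =>
    obtain ⟨l, hl, rfl⟩ := hy
    exact Submodule.subset_span ⟨j :: l, by simpa using h _ hl, by simp⟩
  | zero => simp
  | add y z _ _ hy hz => rw [mul_add]; exact add_mem hy hz
  | smul c y _ hy => rw [mul_smul_comm]; exact Submodule.smul_mem _ _ hy

theorem wordSpan_mul_right (w : ℕ+ → ℕ) {s s' : Set ℕ} (j : ℕ+) (h : ∀ a ∈ s, a + w j ∈ s')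
    {t : FreeAlgebra k ℕ+} (ht : t ∈ wordSpan k w s) :
    t * FreeAlgebra.ι k j ∈ wordSpan k w s' := by
  induction ht using Submodule.span_induction with
  | mem y hy =>
    obtain ⟨l, hl, rfl⟩ := hy
    exact Submodule.subset_span ⟨l ++ [j], by simpa using h _ hl, by simp⟩
  | zero => simp
  | add y z _ _ hy hz => rw [add_mul]; exact add_mem hy hz
  | smul c y _ hy => rw [smul_mul_assoc]; exact Submodule.smul_mem _ _ hy

variable (w : ℕ+ → ℕ) {B : Type*} [Ring B] [Algebra k B] (φ : FreeAlgebra k ℕ+ →ₐ[k] B)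
  (J : Ideal (UW k))

theorem grSpan_mul_left (a : FreeAlgebra k ℕ+) {b : B} (hb : b ∈ grSpan w φ J) :
    φ a * b ∈ grSpan w φ J := by
  induction a using FreeAlgebra.induction generalizing b with
  | grade0 c =>
    rw [AlgHom.commutes, ← Algebra.smul_def]
    exact Submodule.smul_mem _ _ hb
  | mul a a' ha ha' => rw [map_mul, mul_assoc]; exact ha (ha' hb)
  | add a a' ha ha' => rw [map_add, add_mul]; exact add_mem (ha hb) (ha' hb)
  | grade1 j =>
    induction hb using Submodule.span_induction with
    | mem y hy =>
      obtain ⟨n, t, ht, rfl, f, hf, v, hv, hvf⟩ := hy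
      refine Submodule.subset_span ⟨w j + n, FreeAlgebra.ι k j * t,
        wordSpan_mul_left w j (by simp) ht, by simp, UW.e k j * f, J.mul_mem_left _ hf,
        FreeAlgebra.ι k j * v, wordSpan_mul_left w j (by simp) hv, ?_⟩
      change evalU k v = _ at hvf
      change evalU k _ = _
      rw [map_mul, map_mul, hvf, mul_sub]
      simp [evalU]
    | zero => simp
    | add y z _ _ hy hz => rw [mul_add]; exact add_mem hy hz
    | smul c y _ hy => rw [mul_smul_comm]; exact Submodule.smul_mem _ _ hy

theorem grSpan_mul_right [J.IsTwoSided] (a : FreeAlgebra k ℕ+) {b : B} (hb : b ∈ grSpan w φ J) :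
    b * φ a ∈ grSpan w φ J := by
  induction a using FreeAlgebra.induction generalizing b with
  | grade0 c =>
    rw [AlgHom.commutes, ← Algebra.commutes, ← Algebra.smul_def]
    exact Submodule.smul_mem _ _ hb
  | mul a a' ha ha' => rw [map_mul, ← mul_assoc]; exact ha' (ha hb)
  | add a a' ha ha' => rw [map_add, mul_add]; exact add_mem (ha hb) (ha' hb)
  | grade1 j =>
    induction hb using Submodule.span_induction with
    | mem y hy =>
      obtain ⟨n, t, ht, rfl, f, hf, v, hv, hvf⟩ := hy
      refine Submodule.subset_span ⟨n + w j, t * FreeAlgebra.ι k j,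
        wordSpan_mul_right w j (by simp) ht, by simp, f * UW.e k j, J.mul_mem_right _ hf,
        v * FreeAlgebra.ι k j, wordSpan_mul_right w j (by simp) hv, ?_⟩
      change evalU k v = _ at hvf
      change evalU k _ = _
      rw [map_mul, map_mul, hvf, sub_mul]
      simp [evalU]
    | zero => simp
    | add y z _ _ hy hz => rw [add_mul]; exact add_mem hy hz
    | smul c y _ hy => rw [smul_mul_assoc]; exact Submodule.smul_mem _ _ hy

variable {φ} in
/-- `gr J` as an ideal. -/
def grIdeal (hφ : Function.Surjective φ) : Ideal B where
  carrier := grSpan w φ J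
  add_mem' := add_mem
  zero_mem' := zero_mem _
  smul_mem' c b hb := by
    obtain ⟨a, rfl⟩ := hφ c
    exact grSpan_mul_left w φ J a hb

variable {φ} in
instance grIdeal_isTwoSided [J.IsTwoSided] (hφ : Function.Surjective φ) :
    (grIdeal w J hφ).IsTwoSided where
  mul_mem_of_left {b} c hb := by
    obtain ⟨a, rfl⟩ := hφ c
    exact grSpan_mul_right w φ J a hb

variable (k) in
theorem evalU_surjective : Function.Surjective (evalU k) := by
  have hι : ∀ y : WittPos k, UniversalEnvelopingAlgebra.ι k y ∈ (evalU k).range := by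
    intro y
    induction y using WittPos.e_induction with
    | mem i => exact ⟨FreeAlgebra.ι k i, by simp [evalU, UW.e]⟩
    | zero => simp
    | add x y hx hy => rw [map_add]; exact add_mem hx hy
    | smul c x hx => rw [map_smul]; exact Subalgebra.smul_mem _ hx c
  intro u
  change u ∈ (evalU k).range
  obtain ⟨t, rfl⟩ : ∃ t, UniversalEnvelopingAlgebra.mkAlgHom k (WittPos k) t = u :=
    Quotient.mk_surjective u
  induction t using TensorAlgebra.induction with
  | algebraMap r => rw [AlgHom.commutes]; exact Subalgebra.algebraMap_mem _ r
  | ι y => exact hι y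
  | mul a b ha hb => rw [map_mul]; exact mul_mem ha hb
  | add a b ha hb => rw [map_add]; exact add_mem ha hb

variable (k) in
theorem evalS_surjective : Function.Surjective (evalS k) := by
  have hι : ∀ y : WittPos k, SymmetricAlgebra.ι k _ y ∈ (evalS k).range := by
    intro y
    induction y using WittPos.e_induction with
    | mem i => exact ⟨FreeAlgebra.ι k i, by simp [evalS, SymW.x]⟩
    | zero => rw [map_zero]; exact zero_mem _
    | add x y hx hy => rw [map_add]; exact add_mem hx hy
    | smul c x hx => rw [map_smul]; exact Subalgebra.smul_mem _ hx c
  intro s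
  change s ∈ (evalS k).range
  induction s using SymmetricAlgebra.induction with
  | algebraMap r => exact Subalgebra.algebraMap_mem _ r
  | ι y => exact hι y
  | mul a b ha hb => exact mul_mem ha hb
  | add a b ha hb => exact add_mem ha hb

/-- `gr_d(J) ◁ U(W₊)`: the ideal spanned by the top-degree components of the elements of `J`, for
the grading of `U(W₊)` with `d(e_i) = i` (so that `gr_d U(W₊) = U(W₊)`). -/
def grD (J : Ideal (UW k)) : Ideal (UW k) :=
  grIdeal (fun i => (i : ℕ)) J (evalU_surjective k)

instance (J : Ideal (UW k)) [J.IsTwoSided] : (grD J).IsTwoSided :=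
  inferInstanceAs (grIdeal _ J (evalU_surjective k)).IsTwoSided

/-- `gr_o(I) ◁ S(W₊) = gr_o U(W₊)`: the ideal of leading symbols of the elements of `I`, for the
order filtration of `U(W₊)`, with `o(e_i) = 1`. -/
def grO (I : Ideal (UW k)) : Ideal (SymW k) :=
  grIdeal (fun _ => 1) I (evalS_surjective k)

/-- `gr_do(I) ◁ S(W₊) = gr_do U(W₊)`: the ideal of leading symbols of the elements of `I`, for the
degree-order filtration of `U(W₊)`, with `do(e_i) = i + 1`. -/
def grDO (I : Ideal (UW k)) : Ideal (SymW k) :=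
  grIdeal (fun i => (i : ℕ) + 1) I (evalS_surjective k)

theorem UW.e_comm (i j : ℕ+) : UW.e k i * UW.e k j - UW.e k j * UW.e k i =
    (((j : ℕ) : k) - ((i : ℕ) : k)) • UW.e k (i + j) := by
  let _ : LieRing (UW k) := LieRing.ofAssociativeRing
  unfold UW.e
  rw [← map_smul, ← WittPos.lie_e, LieHom.map_lie, LieRing.of_associative_ring_bracket]

theorem PoissonAlgebra.pb_mul_left {A : Type*} [CommRing A] [Algebra k A] [PoissonAlgebra k A]
    (a b c : A) : PoissonAlgebra.pb (k := k) (a * b) c =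
      a * PoissonAlgebra.pb (k := k) b c + b * PoissonAlgebra.pb (k := k) a c := by
  rw [PoissonAlgebra.pb_swap, PoissonAlgebra.pb_mul, PoissonAlgebra.pb_swap b c,
    PoissonAlgebra.pb_swap a c]
  ring

theorem PoissonAlgebra.pb_one {A : Type*} [CommRing A] [Algebra k A] [PoissonAlgebra k A]
    (a : A) : PoissonAlgebra.pb (k := k) a 1 = 0 := by
  simpa using PoissonAlgebra.pb_mul (k := k) a 1 1

/-- The adjoint action of `e_j` lifts to words, preserving their length, compatibly with the
commutator in `U(W₊)` and the Poisson bracket in `S(W₊)`. -/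
theorem exists_ad_word (j : ℕ+) (l : List ℕ+) :
    ∃ t' ∈ wordSpan k (fun _ => 1) {l.length},
      evalU k t' = UW.e k j * evalU k (l.map (FreeAlgebra.ι k)).prod
        - evalU k (l.map (FreeAlgebra.ι k)).prod * UW.e k j ∧
      evalS k t' = PoissonAlgebra.pb (k := k) (SymW.x k j)
        (evalS k (l.map (FreeAlgebra.ι k)).prod) := by
  induction l with
  | nil => exact ⟨0, zero_mem _, by simp, by simp [PoissonAlgebra.pb_one]⟩
  | cons i l ih =>
    obtain ⟨t, ht, hU, hS⟩ := ih
    have hl : (l.map (FreeAlgebra.ι k)).prod ∈ wordSpan k (fun _ => 1) {l.length} :=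
      Submodule.subset_span ⟨l, by simp, rfl⟩
    refine ⟨((((i : ℕ) : k) - ((j : ℕ) : k)) •
        (FreeAlgebra.ι k (j + i) * (l.map (FreeAlgebra.ι k)).prod)) + FreeAlgebra.ι k i * t,
      add_mem (Submodule.smul_mem _ _ (wordSpan_mul_left _ _ (by simp [add_comm]) hl))
        (wordSpan_mul_left _ _ (by simp [add_comm]) ht), ?_, ?_⟩
    · have hi : ∀ i, evalU k (FreeAlgebra.ι k i) = UW.e k i := fun i => by simp [evalU]
      simp only [List.map_cons, List.prod_cons, map_add, map_smul, map_mul, hi, hU]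
      rw [← smul_mul_assoc, ← UW.e_comm]
      noncomm_ring
    · have hi : ∀ i, evalS k (FreeAlgebra.ι k i) = SymW.x k i := fun i => by simp [evalS]
      simp only [List.map_cons, List.prod_cons, map_add, map_smul, map_mul, hi, hS]
      rw [← smul_mul_assoc, ← SymW.pb_x, PoissonAlgebra.pb_mul]

theorem exists_ad (j : ℕ+) (s : Set ℕ) {t : FreeAlgebra k ℕ+}
    (ht : t ∈ wordSpan k (fun _ => 1) s) : ∃ t' ∈ wordSpan k (fun _ => 1) s,
      evalU k t' = UW.e k j * evalU k t - evalU k t * UW.e k j ∧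
      evalS k t' = PoissonAlgebra.pb (k := k) (SymW.x k j) (evalS k t) := by
  induction ht using Submodule.span_induction with
  | mem y hy =>
    obtain ⟨l, hl, rfl⟩ := hy
    obtain ⟨t', ht', h⟩ := exists_ad_word (k := k) j l
    refine ⟨t', Submodule.span_mono (Set.image_mono ?_) ht', h⟩
    intro l' hl'
    simp only [List.map_const', List.sum_replicate, smul_eq_mul, mul_one, Set.mem_ofPred_eq,
      Set.mem_singleton_iff] at hl hl' ⊢
    rwa [hl']
  | zero => exact ⟨0, zero_mem _, by simp, by simp⟩
  | add y z _ _ hy hz =>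
    obtain ⟨y', hy', hU, hS⟩ := hy
    obtain ⟨z', hz', hU', hS'⟩ := hz
    refine ⟨y' + z', add_mem hy' hz', ?_, ?_⟩
    · simp only [map_add, hU, hU', mul_add, add_mul]; abel
    · simp only [map_add, hS, hS']
  | smul c y _ hy =>
    obtain ⟨y', hy', hU, hS⟩ := hy
    refine ⟨c • y', Submodule.smul_mem _ _ hy', ?_, ?_⟩
    · simp only [map_smul, hU, mul_smul_comm, smul_mul_assoc, smul_sub]
    · simp only [map_smul, hS]

/-- `gr_o(I)` is a Poisson ideal of `S(W₊)`. -/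
instance grO_isPoisson (I : Ideal (UW k)) [I.IsTwoSided] : IsPoissonIdeal k (grO I) where
  pb_mem a b hb := by
    obtain ⟨a, rfl⟩ := evalS_surjective k a
    induction a using FreeAlgebra.induction with
    | grade0 c =>
      rw [AlgHom.commutes, PoissonAlgebra.pb_swap, Algebra.algebraMap_eq_smul_one, map_smul,
        PoissonAlgebra.pb_one, smul_zero, neg_zero]
      exact zero_mem _
    | mul a a' ha ha' =>
      rw [map_mul, PoissonAlgebra.pb_mul_left]
      exact add_mem (Ideal.mul_mem_left _ _ ha') (Ideal.mul_mem_left _ _ ha)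
    | add a a' ha ha' =>
      rw [map_add, map_add, LinearMap.add_apply]
      exact add_mem ha ha'
    | grade1 j =>
      have hj : evalS k (FreeAlgebra.ι k j) = SymW.x k j := by simp [evalS]
      rw [hj]
      change b ∈ grSpan _ (evalS k) I at hb
      change _ ∈ grSpan _ (evalS k) I
      induction hb using Submodule.span_induction with
      | mem y hy =>
        obtain ⟨n, t, ht, rfl, f, hf, v, hv, hvf⟩ := hy
        obtain ⟨t', ht', hU, hS⟩ := exists_ad j _ ht
        obtain ⟨v', hv', hU', -⟩ := exists_ad j _ hv
        refine Submodule.subset_span ⟨n, t', ht', hS, UW.e k j * f - f * UW.e k j,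
          sub_mem (I.mul_mem_left _ hf) (I.mul_mem_right _ hf), v', hv', ?_⟩
        change evalU k v = _ at hvf
        change evalU k v' = _
        rw [hU', hU, hvf]
        noncomm_ring
      | zero => rw [map_zero]; exact zero_mem _
      | add y z _ _ hy hz => rw [map_add]; exact add_mem hy hz
      | smul c y _ hy => rw [map_smul]; exact Submodule.smul_mem _ _ hy

end Gr

end

/-!
Pull everything back to the free algebra `P` on the letters `i ≥ 1`, where an ideal becomes a
subspace `L`. For a weight `w`, the component of weight `n` of the associated graded ideal is
recorded by the leading terms of weight `n`: the combinations of words of weight `n` that lie in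
`L` up to words of smaller weight.

* Passing to the associated graded ideal does not change the leading terms: for `gr_d` because the
  kernel of `P → U(W₊)` is homogeneous for the degree, and for the ideals of `S(W₊)` because an
  element of weight `n` that dies in `S(W₊)` has image of smaller weight in `U(W₊)` (the easy half
  of PBW).
* If `L` is homogeneous for the degree, the leading terms for the order and for the degree-order
  span the same subspace, since on a component of fixed degree the two weights differ by a constant.
* The dimension of the `n`-th piece of the weight filtration of `P / L` is the number of words of
  weight `≤ n` minus the dimensions of the spaces of leading terms of weight `≤ n`. Its growth
  exponent is `GKdim`, respectively `PGKdim`, because `e_1` and `e_2` generate every `e_n` in at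
  most `n` steps.
-/

/-! ### Growth of filtrations -/

theorem growthExponent_le_of_le {f g : ℕ → ℕ} {m : ℕ} (hm : 0 < m) (h : ∀ n, f n ≤ g (m * n)) :
    growthExponent f ≤ growthExponent g := by
  refine le_iInf₂ fun γ ⟨c, m', hc⟩ => iInf₂_le γ ⟨c, m' * m, ?_⟩
  have hm : Filter.Tendsto (m * ·) Filter.atTop Filter.atTop :=
    Filter.tendsto_id.const_mul_atTop' hm
  filter_upwards [hm.eventually hc] with n hn
  calc (f n : ℝ) ≤ g (m * n) := by exact_mod_cast h n
    _ ≤ _ := hn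
    _ = _ := by rw [mul_assoc]

section Filtration

variable {k M : Type*} [Field k] [AddCommGroup M] [Module k M]

theorem exists_le_of_fg {F : ℕ → Submodule k M} (hF : Monotone F) (hexh : ∀ b, ∃ n, b ∈ F n)
    {V : Submodule k M} (hV : V.FG) : ∃ n, V ≤ F n := by
  induction V, hV using Submodule.fg_induction with
  | singleton b => simpa only [Submodule.span_singleton_le_iff_mem] using hexh b
  | sup V V' _ _ hV hV' =>
    obtain ⟨m, hm⟩ := hV
    obtain ⟨n, hn⟩ := hV'
    exact ⟨max m n, sup_le (hm.trans (hF (le_max_left m n))) (hn.trans (hF (le_max_right m n)))⟩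

theorem le_iSup_range (p : ℕ → Submodule k M) {i n : ℕ} (h : i ≤ n) :
    p i ≤ ⨆ j ∈ Finset.range (n + 1), p j :=
  le_biSup p (Finset.mem_range_succ_iff.2 h)

/-- Both `GKdim` and `PGKdim` have the shape of the left-hand side, with `P V i` the `i`-th power,
respectively Poisson power, of `V`. -/
theorem iSup_growthExponent_eq {F : ℕ → Submodule k M} (hF : Monotone F)
    (hfin : ∀ n, FiniteDimensional k (F n)) (hexh : ∀ b, ∃ n, b ∈ F n)
    {P : Submodule k M → ℕ → Submodule k M}
    (hP : ∀ V m, V ≤ F m → ∀ i, P V i ≤ F (m * i)) {V₀ : Submodule k M} (hV₀ : V₀.FG)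
    (hPV₀ : ∀ n, (P V₀ n).FG) (hgen : ∀ n, F n ≤ ⨆ i ∈ Finset.range (n + 1), P V₀ i) :
    ⨆ (V : Submodule k M) (_ : V.FG), growthExponent (fun n =>
      Module.finrank k ↥(⨆ i ∈ Finset.range (n + 1), P V i)) =
      growthExponent fun n => Module.finrank k (F n) := by
  refine le_antisymm (iSup₂_le fun V hV => ?_) (le_iSup₂_of_le V₀ hV₀ ?_)
  · obtain ⟨m, hm⟩ := exists_le_of_fg hF hexh hV
    refine growthExponent_le_of_le m.succ_pos fun n =>
      Submodule.finrank_mono (iSup₂_le fun i hi => ?_)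
    exact (hP V _ (hm.trans (hF m.le_succ)) i).trans
      (hF (Nat.mul_le_mul_left _ (Finset.mem_range_succ_iff.1 hi)))
  · refine growthExponent_le_of_le one_pos fun n => ?_
    have : FiniteDimensional k ↥(⨆ i ∈ Finset.range (n + 1), P V₀ i) :=
      Module.Finite.iff_fg.2 (Submodule.fg_biSup _ _ fun i _ => hPV₀ i)
    rw [one_mul]
    exact Submodule.finrank_mono (hgen n)

end Filtration

/-! ### The grading of the free algebra by weight -/

section Words

variable {k : Type*} [Field k] {w : ℕ+ → ℕ}

variable (k) in
/-- The word `i_1 ⋯ i_r` as an element of the free algebra. -/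
noncomputable def word (l : List ℕ+) : FreeAlgebra k ℕ+ := (l.map (FreeAlgebra.ι k)).prod

theorem word_nil : word k [] = 1 := rfl

theorem word_cons (i : ℕ+) (l : List ℕ+) : word k (i :: l) = FreeAlgebra.ι k i * word k l :=
  List.prod_cons

theorem word_append (l l' : List ℕ+) : word k (l ++ l') = word k l * word k l' := by
  simp only [word, List.map_append, List.prod_append]

theorem word_singleton (i : ℕ+) : word k [i] = FreeAlgebra.ι k i := by
  rw [word_cons, word_nil, mul_one]

theorem word_mem_wordSpan {s : Set ℕ} {l : List ℕ+} (h : (l.map w).sum ∈ s) :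
    word k l ∈ wordSpan k w s :=
  Submodule.subset_span ⟨l, h, rfl⟩

theorem ι_mem_wordSpan (i : ℕ+) : FreeAlgebra.ι k i ∈ wordSpan k w {w i} :=
  word_singleton (k := k) i ▸ word_mem_wordSpan (by simp)

theorem wordSpan_le {s : Set ℕ} {N : Submodule k (FreeAlgebra k ℕ+)} :
    wordSpan k w s ≤ N ↔ ∀ l : List ℕ+, (l.map w).sum ∈ s → word k l ∈ N :=
  Submodule.span_le.trans Set.image_subset_iff

theorem wordSpan_mono {s s' : Set ℕ} (h : s ⊆ s') : wordSpan k w s ≤ wordSpan k w s' :=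
  wordSpan_le.2 fun _ hl => word_mem_wordSpan (h hl)

theorem wordSpan_union (s s' : Set ℕ) :
    wordSpan k w (s ∪ s') = wordSpan k w s ⊔ wordSpan k w s' := by
  rw [wordSpan, wordSpan, wordSpan, ← Submodule.span_union, ← Set.image_union]
  rfl

theorem wordSpan_empty : wordSpan k w ∅ = ⊥ :=
  le_bot_iff.1 (wordSpan_le.2 fun _ hl => hl.elim)

theorem wordSpan_mul_le {s s' s'' : Set ℕ} (h : ∀ a ∈ s, ∀ b ∈ s', a + b ∈ s'') :
    wordSpan k w s * wordSpan k w s' ≤ wordSpan k w s'' := by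
  rw [wordSpan, wordSpan, Submodule.span_mul_span, Submodule.span_le]
  rintro _ ⟨_, ⟨l, hl, rfl⟩, _, ⟨l', hl', rfl⟩, rfl⟩
  change word k l * word k l' ∈ wordSpan k w s''
  rw [← word_append]
  exact word_mem_wordSpan (by simpa using h _ hl _ hl')

theorem finite_setOf_weight_lt (hw : ∀ i : ℕ+, (i : ℕ) ≤ w i) (n : ℕ) :
    {l : List ℕ+ | (l.map w).sum < n}.Finite := by
  induction n with
  | zero => simp
  | succ n ih =>
    refine ((Set.finite_singleton []).union
      ((Set.finite_Iic n.succPNat).image2 List.cons ih)).subset ?_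
    rintro (_ | ⟨i, l⟩) hl
    · exact Or.inl rfl
    · have hl : w i + (l.map w).sum < n + 1 := by simpa using hl
      have hi := hw i
      refine Or.inr ⟨i, ?_, l, ?_, rfl⟩
      · rw [Set.mem_Iic, ← PNat.coe_le_coe, Nat.succPNat_coe]
        omega
      · have := i.pos
        change (l.map w).sum < n
        omega

theorem wordSpan_finite (hw : ∀ i : ℕ+, (i : ℕ) ≤ w i) {s : Set ℕ} (hs : BddAbove s) :
    FiniteDimensional k (wordSpan k w s) := by
  obtain ⟨n, hn⟩ := hs
  exact FiniteDimensional.span_of_finite k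
    (((finite_setOf_weight_lt hw (n + 1)).subset fun _ hl => Nat.lt_succ_of_le (hn hl)).image _)

variable (w) in
instance wordSpan_gradedMonoid : SetLike.GradedMonoid fun n => wordSpan k w {n} where
  one_mem := word_mem_wordSpan (l := []) rfl
  mul_mem _ _ _ _ hx hy :=
    wordSpan_mul_le (by rintro a rfl b rfl; rfl) (Submodule.mul_mem_mul hx hy)

variable (w) in
/-- The algebra homomorphism `i ↦ i` from the free algebra to the direct sum of its components. -/
noncomputable def wordDecompose : FreeAlgebra k ℕ+ →ₐ[k] DirectSum ℕ fun n => wordSpan k w {n} :=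
  FreeAlgebra.lift k fun i => DirectSum.of (fun n => wordSpan k w {n}) (w i)
    ⟨FreeAlgebra.ι k i, ι_mem_wordSpan i⟩

theorem wordDecompose_word (l : List ℕ+) :
    wordDecompose w (word k l) = DirectSum.of (fun n => wordSpan k w {n}) (l.map w).sum
      ⟨word k l, word_mem_wordSpan (Set.mem_singleton _)⟩ := by
  induction l with
  | nil => exact map_one _
  | cons i l ih =>
    calc wordDecompose w (word k (i :: l))
        = wordDecompose w (FreeAlgebra.ι k i) * wordDecompose w (word k l) := by
          rw [word_cons, map_mul]
      _ = _ := by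
          rw [ih, wordDecompose, FreeAlgebra.lift_ι_apply, DirectSum.of_mul_of]
          exact DirectSum.of_eq_of_gradedMonoid_eq
            (Sigma.subtype_ext List.sum_cons.symm (word_cons i l).symm)

noncomputable instance wordSpan_gradedAlgebra : GradedAlgebra fun n => wordSpan k w {n} :=
  GradedAlgebra.ofAlgHom _ (wordDecompose w)
    (by ext i; simp [wordDecompose])
    fun n t => by
      have h : (wordDecompose w).toLinearMap ∘ₗ (wordSpan k w {n}).subtype =
          DirectSum.lof k ℕ (fun n => wordSpan k w {n}) n := by
        refine (Submodule.linearMap_eq_iff_of_eq_span _ _ rfl).2 ?_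
        rintro ⟨_, l, rfl, rfl⟩
        exact wordDecompose_word l
      exact LinearMap.congr_fun h t

variable (k w) in
/-- The projection onto the component of weight `n`. -/
noncomputable def weightProj (n : ℕ) : FreeAlgebra k ℕ+ →ₗ[k] FreeAlgebra k ℕ+ :=
  GradedAlgebra.proj (fun n => wordSpan k w {n}) n

theorem weightProj_mem (n : ℕ) (t : FreeAlgebra k ℕ+) : weightProj k w n t ∈ wordSpan k w {n} :=
  SetLike.coe_mem _

theorem weightProj_of_mem {n : ℕ} {t : FreeAlgebra k ℕ+} (ht : t ∈ wordSpan k w {n}) :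
    weightProj k w n t = t :=
  DirectSum.decompose_of_mem_same (fun n => wordSpan k w {n}) ht

theorem weightProj_word (n : ℕ) (l : List ℕ+) :
    weightProj k w n (word k l) = if (l.map w).sum = n then word k l else 0 := by
  have hl : word k l ∈ wordSpan k w {(l.map w).sum} := word_mem_wordSpan (Set.mem_singleton _)
  split_ifs with h
  · exact weightProj_of_mem (h ▸ hl)
  · exact DirectSum.decompose_of_mem_ne (fun n => wordSpan k w {n}) hl h

end Words

/-! ### Leading terms -/

section LeadingTerms

variable {k : Type*} [Field k] {w w' : ℕ+ → ℕ} {L H : Submodule k (FreeAlgebra k ℕ+)}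

theorem mem_of_forall_weightProj_mem {t : FreeAlgebra k ℕ+}
    (h : ∀ n, weightProj k w n t ∈ L) : t ∈ L := by
  classical
  rw [← DirectSum.sum_support_decompose (fun n => wordSpan k w {n}) t]
  exact sum_mem fun n _ => h n

theorem wordSpan_univ : wordSpan k w Set.univ = ⊤ :=
  eq_top_iff.2 fun _ _ => mem_of_forall_weightProj_mem (w := w) fun n =>
    wordSpan_mono (Set.subset_univ _) (weightProj_mem n _)

theorem wordSpan_le_comap_weightProj {w'' : ℕ+ → ℕ} {s s' : Set ℕ} {n : ℕ}
    (h : ∀ l : List ℕ+, (l.map w').sum ∈ s → (l.map w).sum = n → (l.map w'').sum ∈ s') :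
    wordSpan k w' s ≤ (wordSpan k w'' s').comap (weightProj k w n) :=
  wordSpan_le.2 fun l hl => by
    rw [Submodule.mem_comap, weightProj_word]
    split_ifs with hn
    exacts [word_mem_wordSpan (h l hl hn), zero_mem _]

theorem weightProj_eq_zero {s : Set ℕ} {n : ℕ} (hn : n ∉ s) {t : FreeAlgebra k ℕ+}
    (ht : t ∈ wordSpan k w s) : weightProj k w n t = 0 := by
  have h := wordSpan_le_comap_weightProj (w := w) (w'' := w) (s' := ∅)
    (fun l hl hln => by rw [hln] at hl; exact hn hl) ht
  rwa [wordSpan_empty] at h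

variable (w L) in
/-- The `w`-leading terms of weight `n` of the elements of `L`, together with `0`. -/
def leadingTerms (n : ℕ) : Submodule k (FreeAlgebra k ℕ+) :=
  wordSpan k w {n} ⊓ (wordSpan k w (Set.Iio n) ⊔ L)

theorem weightProj_mem_leadingTerms {t : FreeAlgebra k ℕ+} (ht : t ∈ ⨆ m, leadingTerms w L m)
    (n : ℕ) : weightProj k w n t ∈ leadingTerms w L n := by
  have h : ⨆ m, leadingTerms w L m ≤ (leadingTerms w L n).comap (weightProj k w n) := by
    refine iSup_le fun m t ht => ?_
    rcases eq_or_ne n m with rfl | hnm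
    · rwa [Submodule.mem_comap, weightProj_of_mem ht.1]
    · rw [Submodule.mem_comap, weightProj_eq_zero (s := {m}) hnm ht.1]
      exact zero_mem _
  exact h ht

theorem iSup_leadingTerms_isHomogeneous :
    (⨆ n, leadingTerms w L n).IsHomogeneous fun n => wordSpan k w {n} := fun n _ ht =>
  Submodule.mem_iSup_of_mem n (weightProj_mem_leadingTerms ht n)

theorem isHomogeneous_sup (hL : L.IsHomogeneous fun n => wordSpan k w {n})
    (hH : H.IsHomogeneous fun n => wordSpan k w {n}) :
    (L ⊔ H).IsHomogeneous fun n => wordSpan k w {n} := fun n t ht => by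
  have h : L ⊔ H ≤ (L ⊔ H).comap (weightProj k w n) :=
    sup_le (fun t ht => Submodule.mem_sup_left (hL n ht))
      fun t ht => Submodule.mem_sup_right (hH n ht)
  exact h ht

/-- A homogeneous element of weight `n` is fixed by the projection onto weight `n`, which kills
`wordSpan k w (Set.Iio n)`. -/
theorem leadingTerms_eq_inf (hL : L.IsHomogeneous fun n => wordSpan k w {n}) (n : ℕ) :
    leadingTerms w L n = wordSpan k w {n} ⊓ L := by
  refine le_antisymm (fun t ht => ⟨ht.1, ?_⟩) (inf_le_inf_left _ le_sup_right)
  have h : wordSpan k w (Set.Iio n) ⊔ L ≤ L.comap (weightProj k w n) := by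
    refine sup_le (fun t ht => ?_) fun t ht => hL n ht
    rw [Submodule.mem_comap, weightProj_eq_zero (s := Set.Iio n) (lt_irrefl n) ht]
    exact zero_mem _
  exact weightProj_of_mem ht.1 ▸ h ht.2

theorem leadingTerms_iSup_sup (hH : H.IsHomogeneous fun n => wordSpan k w {n})
    (hHL : ∀ n, wordSpan k w {n} ⊓ H ≤ wordSpan k w (Set.Iio n) ⊔ L) (n : ℕ) :
    leadingTerms w ((⨆ m, leadingTerms w L m) ⊔ H) n = leadingTerms w L n := by
  have h : (⨆ m, leadingTerms w L m) ⊔ H ≤ (leadingTerms w L n).comap (weightProj k w n) :=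
    sup_le (fun t ht => weightProj_mem_leadingTerms ht n) fun t ht =>
      ⟨weightProj_mem n t, hHL n ⟨weightProj_mem n t, hH n ht⟩⟩
  rw [leadingTerms_eq_inf (isHomogeneous_sup iSup_leadingTerms_isHomogeneous hH)]
  exact le_antisymm (fun t ht => weightProj_of_mem ht.1 ▸ h ht.2) fun t ht =>
    ⟨ht.1, Submodule.mem_sup_left (Submodule.mem_iSup_of_mem n ht)⟩

theorem leadingTerms_le_iSup_leadingTerms {d : ℕ+ → ℕ}
    (hL : L.IsHomogeneous fun n => wordSpan k d {n})
    (h : ∀ n m, ∃ n', ∀ l : List ℕ+, (l.map d).sum = m →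
      ((l.map w).sum = n → (l.map w').sum = n') ∧ ((l.map w).sum < n → (l.map w').sum < n'))
    (n : ℕ) : leadingTerms w L n ≤ ⨆ n', leadingTerms w' L n' := by
  rintro t ⟨ht, htL⟩
  refine mem_of_forall_weightProj_mem (w := d) fun m => ?_
  obtain ⟨n', hn'⟩ := h n m
  have hlow : wordSpan k w (Set.Iio n) ⊔ L ≤
      (wordSpan k w' (Set.Iio n') ⊔ L).comap (weightProj k d m) :=
    sup_le ((wordSpan_le_comap_weightProj fun l hl hlm => (hn' l hlm).2 hl).trans
      (Submodule.comap_mono le_sup_left)) fun t ht => Submodule.mem_sup_right (hL m ht)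
  exact Submodule.mem_iSup_of_mem n'
    ⟨wordSpan_le_comap_weightProj (fun l hl hlm => (hn' l hlm).1 hl) ht, hlow htL⟩

theorem iSup_leadingTerms_add_eq {d : ℕ+ → ℕ} (hL : L.IsHomogeneous fun n => wordSpan k d {n}) :
    ⨆ n, leadingTerms (fun i => d i + w i) L n = ⨆ n, leadingTerms w L n := by
  refine le_antisymm
    (iSup_le (leadingTerms_le_iSup_leadingTerms hL fun n m => ?_))
    (iSup_le (leadingTerms_le_iSup_leadingTerms hL fun n m => ?_))
  · rcases le_or_gt m n with hmn | hmn
    · refine ⟨n - m, fun l hl => ?_⟩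
      rw [List.sum_map_add]
      omega
    · exact ⟨0, fun l hl => by rw [List.sum_map_add]; omega⟩
  · refine ⟨m + n, fun l hl => ?_⟩
    rw [List.sum_map_add]
    omega

end LeadingTerms

/-! ### Symbols of elements of `U(W₊)` -/

section Symbols

variable {k : Type*} [Field k] {w : ℕ+ → ℕ}

theorem evalU_ι (i : ℕ+) : evalU k (FreeAlgebra.ι k i) = UW.e k i := FreeAlgebra.lift_ι_apply _ _

theorem evalS_ι (i : ℕ+) : evalS k (FreeAlgebra.ι k i) = SymW.x k i := FreeAlgebra.lift_ι_apply _ _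

/-- The homogeneous components of `φ t` are the coefficients of `δ (φ t)`. -/
theorem ker_isHomogeneous {B : Type*} [Ring B] [Algebra k B] {φ : FreeAlgebra k ℕ+ →ₐ[k] B}
    (δ : B →ₐ[k] Polynomial B)
    (hδ : ∀ i, δ (φ (FreeAlgebra.ι k i)) = Polynomial.monomial (w i) (φ (FreeAlgebra.ι k i))) :
    (LinearMap.ker φ.toLinearMap).IsHomogeneous fun n => wordSpan k w {n} := by
  have hword : ∀ l : List ℕ+,
      δ (φ (word k l)) = Polynomial.monomial (l.map w).sum (φ (word k l)) := by
    intro l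
    induction l with
    | nil => rw [word_nil, map_one, map_one]; rfl
    | cons i l ih =>
      rw [word_cons, map_mul, map_mul, hδ, ih, Polynomial.monomial_mul_monomial, List.map_cons,
        List.sum_cons]
  have hcoeff : ∀ n t, (δ (φ t)).coeff n = φ (weightProj k w n t) := by
    intro n t
    have h : wordSpan k w Set.univ ≤ LinearMap.eqLocus
        (((Polynomial.lcoeff B n).restrictScalars k) ∘ₗ δ.toLinearMap ∘ₗ φ.toLinearMap)
        (φ.toLinearMap ∘ₗ weightProj k w n) := wordSpan_le.2 fun l _ => by
      change (δ (φ (word k l))).coeff n = φ (weightProj k w n (word k l))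
      rw [hword, Polynomial.coeff_monomial, weightProj_word, apply_ite φ, map_zero]
    exact h (wordSpan_univ (k := k) (w := w) ▸ Submodule.mem_top)
  intro n t ht
  change φ (weightProj k w n t) = 0
  rw [← hcoeff, show φ t = 0 from ht, map_zero, Polynomial.coeff_zero]

theorem ker_evalS_isHomogeneous :
    (LinearMap.ker (evalS k).toLinearMap).IsHomogeneous fun n => wordSpan k w {n} :=
  ker_isHomogeneous (SymmetricAlgebra.lift ((WittPos.basis k).constr k fun i =>
      Polynomial.monomial (w i) (SymW.x k i))) fun i => by
    rw [evalS_ι, SymW.x, SymmetricAlgebra.lift_ι_apply]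
    exact Module.Basis.constr_basis _ _ _ _

attribute [local instance] LieRing.ofAssociativeRing LieAlgebra.ofAssociativeAlgebra in
theorem UW.exists_algHom {A : Type*} [Ring A] [Algebra k A] (a : ℕ+ → A)
    (ha : ∀ i j, a i * a j - a j * a i = (((j : ℕ) : k) - ((i : ℕ) : k)) • a (i + j)) :
    ∃ f : UW k →ₐ[k] A, ∀ i, f (UW.e k i) = a i := by
  set g : WittPos k →ₗ[k] A := (WittPos.basis k).constr k a
  have hg : ∀ i, g (WittPos.e k i) = a i := Module.Basis.constr_basis _ _ _
  have hlie : (WittPos.bracket k).compr₂ g =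
      (LinearMap.mul k A - (LinearMap.mul k A).flip).compl₁₂ g g := by
    refine (WittPos.basis k).ext fun i => (WittPos.basis k).ext fun j => ?_
    change g (WittPos.bracket k (WittPos.e k i) (WittPos.e k j)) =
      g (WittPos.e k i) * g (WittPos.e k j) - g (WittPos.e k j) * g (WittPos.e k i)
    rw [WittPos.bracket_e, map_smul, hg, hg, hg, ha]
  refine ⟨UniversalEnvelopingAlgebra.lift k
    { g with map_lie' := fun {x y} => LinearMap.congr_fun₂ hlie x y }, fun i => ?_⟩
  rw [UW.e, UniversalEnvelopingAlgebra.lift_ι_apply]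
  exact hg i

theorem ker_evalU_isHomogeneous :
    (LinearMap.ker (evalU k).toLinearMap).IsHomogeneous
      fun n => wordSpan k (fun i => (i : ℕ)) {n} := by
  obtain ⟨δ, hδ⟩ := UW.exists_algHom
    (fun i => Polynomial.monomial (i : ℕ) (UW.e k i)) fun i j => by
    rw [Polynomial.monomial_mul_monomial, Polynomial.monomial_mul_monomial,
      add_comm (j : ℕ) (i : ℕ), ← map_sub, UW.e_comm, PNat.add_coe]
    exact (Polynomial.smul_monomial _ _ _).symm
  exact ker_isHomogeneous δ fun i => by rw [evalU_ι, hδ]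

theorem e_mul_mem_filtLT (i : ℕ+) {n : ℕ} {u : UW k} (hu : u ∈ filtLT k w n) :
    UW.e k i * u ∈ filtLT k w (w i + n) := by
  obtain ⟨t, ht, rfl⟩ := hu
  refine ⟨FreeAlgebra.ι k i * t,
    wordSpan_mul_left w i (fun a ha => Set.mem_Iio.2 (Nat.add_lt_add_left ha _)) ht, ?_⟩
  exact (map_mul (evalU k) _ _).trans (congrArg (· * _) (evalU_ι i))

theorem evalU_word_sub_mem_filtLT_of_perm (hw : ∀ i j, w (i + j) < w i + w j) {l l' : List ℕ+}
    (h : l.Perm l') : evalU k (word k l) - evalU k (word k l') ∈ filtLT k w (l.map w).sum := by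
  induction h with
  | nil => simp
  | cons i _ ih =>
    rw [word_cons, word_cons, map_mul, map_mul, ← mul_sub, evalU_ι, List.map_cons, List.sum_cons]
    exact e_mul_mem_filtLT i ih
  | swap i j l =>
    have h : evalU k (word k (j :: i :: l)) - evalU k (word k (i :: j :: l)) =
        evalU k ((((i : ℕ) : k) - ((j : ℕ) : k)) • word k ((j + i) :: l)) := by
      simp only [word_cons, map_mul, map_smul, evalU_ι]
      rw [← smul_mul_assoc, ← UW.e_comm]
      noncomm_ring
    rw [h]
    refine ⟨_, Submodule.smul_mem _ _ (word_mem_wordSpan ?_), rfl⟩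
    have := hw j i
    simp only [List.map_cons, List.sum_cons, Set.mem_Iio]
    omega
  | trans h₁ _ ih₁ ih₂ =>
    rw [← (h₁.map w).sum_eq] at ih₂
    simpa using add_mem ih₁ ih₂

variable (k) in
/-- A linear section of `evalS`: each monomial is sent to the product of its factors in some
order. -/
noncomputable def symbolSection : SymW k →ₗ[k] FreeAlgebra k ℕ+ :=
  (MvPolynomial.basisMonomials ℕ+ k).constr k (fun s => word k (Finsupp.toMultiset s).toList) ∘ₗ
    (SymW.equivPoly k).toLinearMap

theorem equivPoly_evalS_word (l : List ℕ+) : SymW.equivPoly k (evalS k (word k l)) =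
    MvPolynomial.monomial (Multiset.toFinsupp (l : Multiset ℕ+)) 1 := by
  induction l with
  | nil => simp [word_nil]
  | cons i l ih =>
    have hi : SymW.equivPoly k (SymW.x k i) = MvPolynomial.X i :=
      SymmetricAlgebra.equivMvPolynomial_ι_apply (WittPos.basis k) i
    rw [word_cons, map_mul, map_mul, ih, evalS_ι, hi, MvPolynomial.X, MvPolynomial.monomial_mul,
      one_mul, ← Multiset.cons_coe, ← Multiset.singleton_add, map_add,
      Multiset.toFinsupp_singleton]

theorem symbolSection_evalS_word (l : List ℕ+) :
    symbolSection k (evalS k (word k l)) = word k (l : Multiset ℕ+).toList := by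
  change (MvPolynomial.basisMonomials ℕ+ k).constr k _ (SymW.equivPoly k _) = _
  rw [equivPoly_evalS_word, ← congrFun (MvPolynomial.coe_basisMonomials ℕ+ k),
    Module.Basis.constr_basis, Multiset.toFinsupp_toMultiset]

theorem evalU_mem_filtLT_of_evalS_eq_zero (hw : ∀ i j, w (i + j) < w i + w j) {n : ℕ}
    {t : FreeAlgebra k ℕ+} (ht : t ∈ wordSpan k w {n}) (h : evalS k t = 0) :
    evalU k t ∈ filtLT k w n := by
  have hsub : wordSpan k w {n} ≤ (filtLT k w n).comap ((evalU k).toLinearMap ∘ₗ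
      (LinearMap.id - symbolSection k ∘ₗ (evalS k).toLinearMap)) := by
    refine wordSpan_le.2 ?_
    rintro l rfl
    change evalU k (word k l - symbolSection k (evalS k (word k l))) ∈ filtLT k w _
    rw [symbolSection_evalS_word, map_sub]
    exact evalU_word_sub_mem_filtLT_of_perm hw
      (Multiset.coe_eq_coe.1 (Multiset.coe_toList _).symm)
  have hmem : evalU k (t - symbolSection k (evalS k t)) ∈ filtLT k w n := hsub ht
  rwa [h, map_zero, sub_zero] at hmem

end Symbols

/-! ### Associated graded ideals -/

section AssociatedGraded

variable {k : Type*} [Field k] {w : ℕ+ → ℕ} {B : Type*} [Ring B] [Algebra k B]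

/-- The preimage in the free algebra, as a subspace, of an ideal of an algebra generated by the
letters. -/
def idealPreimage (φ : FreeAlgebra k ℕ+ →ₐ[k] B) (J : Ideal B) : Submodule k (FreeAlgebra k ℕ+) :=
  (J.restrictScalars k).comap φ.toLinearMap

theorem ker_le_idealPreimage (φ : FreeAlgebra k ℕ+ →ₐ[k] B) (J : Ideal B) :
    LinearMap.ker φ.toLinearMap ≤ idealPreimage φ J :=
  Submodule.comap_mono bot_le

theorem ker_mkₐ_comp (φ : FreeAlgebra k ℕ+ →ₐ[k] B)
    (J : Ideal B) [J.IsTwoSided] :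
    LinearMap.ker ((Ideal.Quotient.mkₐ k J).comp φ).toLinearMap = idealPreimage φ J :=
  Submodule.ext fun _ => Ideal.Quotient.eq_zero_iff_mem

theorem mem_leadingTerms_idealPreimage {J : Ideal (UW k)} {n : ℕ} {t : FreeAlgebra k ℕ+} :
    t ∈ leadingTerms w (idealPreimage (evalU k) J) n ↔
      t ∈ wordSpan k w {n} ∧ ∃ f ∈ J, f - evalU k t ∈ filtLT k w n := by
  refine and_congr_right fun _ => Submodule.mem_sup.trans ⟨?_, ?_⟩
  · rintro ⟨u, hu, v, hv, rfl⟩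
    refine ⟨evalU k v, hv, -u, neg_mem hu, ?_⟩
    change evalU k (-u) = _
    rw [map_neg, map_add, sub_add_cancel_right]
  · rintro ⟨f, hf, u, hu, huf⟩
    have huf : evalU k u = f - evalU k t := huf
    refine ⟨-u, neg_mem hu, t + u, ?_, neg_add_cancel_comm_assoc u t⟩
    change evalU k (t + u) ∈ J
    rwa [map_add, huf, add_sub_cancel]

theorem grSpan_eq_map (φ : FreeAlgebra k ℕ+ →ₐ[k] B) (J : Ideal (UW k)) :
    grSpan w φ J =
      (⨆ n, leadingTerms w (idealPreimage (evalU k) J) n).map φ.toLinearMap := by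
  rw [Submodule.map_iSup]
  refine le_antisymm (Submodule.span_le.2 ?_) (iSup_le ?_)
  · rintro _ ⟨n, t, ht, rfl, hf⟩
    exact Submodule.mem_iSup_of_mem n ⟨t, mem_leadingTerms_idealPreimage.2 ⟨ht, hf⟩, rfl⟩
  · rintro n _ ⟨t, ht, rfl⟩
    obtain ⟨ht, hf⟩ := mem_leadingTerms_idealPreimage.1 ht
    exact Submodule.subset_span ⟨n, t, ht, rfl, hf⟩

theorem idealPreimage_grIdeal {φ : FreeAlgebra k ℕ+ →ₐ[k] B} (hφ : Function.Surjective φ)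
    (J : Ideal (UW k)) : idealPreimage φ (grIdeal w J hφ) =
      (⨆ n, leadingTerms w (idealPreimage (evalU k) J) n) ⊔ LinearMap.ker φ.toLinearMap := by
  change (grSpan w φ J).comap φ.toLinearMap = _
  rw [grSpan_eq_map, Submodule.comap_map_eq]

theorem leadingTerms_idealPreimage_grD (J : Ideal (UW k)) (n : ℕ) :
    leadingTerms (fun i => (i : ℕ)) (idealPreimage (evalU k) (grD J)) n =
      leadingTerms (fun i => (i : ℕ)) (idealPreimage (evalU k) J) n := by
  rw [grD, idealPreimage_grIdeal]
  exact leadingTerms_iSup_sup ker_evalU_isHomogeneous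
    (fun _ => inf_le_right.trans ((ker_le_idealPreimage _ J).trans le_sup_right)) n

theorem leadingTerms_idealPreimage_evalS (hw : ∀ i j, w (i + j) < w i + w j) (I : Ideal (UW k))
    (n : ℕ) : leadingTerms w (idealPreimage (evalS k) (grIdeal w I (evalS_surjective k))) n =
      leadingTerms w (idealPreimage (evalU k) I) n := by
  rw [idealPreimage_grIdeal]
  refine leadingTerms_iSup_sup ker_evalS_isHomogeneous (fun m t ht => ?_) n
  have htU : t ∈ (filtLT k w m).comap (evalU k).toLinearMap :=
    evalU_mem_filtLT_of_evalS_eq_zero hw ht.1 ht.2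
  rw [filtLT, Submodule.comap_map_eq] at htU
  exact sup_le_sup_left (ker_le_idealPreimage _ I) _ htU

theorem idealPreimage_grD_isHomogeneous (J : Ideal (UW k)) :
    (idealPreimage (evalU k) (grD J)).IsHomogeneous
      fun n => wordSpan k (fun i => (i : ℕ)) {n} := by
  rw [grD, idealPreimage_grIdeal]
  exact isHomogeneous_sup iSup_leadingTerms_isHomogeneous ker_evalU_isHomogeneous

theorem grO_grD_eq_grDO_grD (J : Ideal (UW k)) : grO (grD J) = grDO (grD J) := by
  have h : grSpan (fun _ => 1) (evalS k) (grD J) =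
      grSpan (fun i => (i : ℕ) + 1) (evalS k) (grD J) := by
    rw [grSpan_eq_map, grSpan_eq_map,
      iSup_leadingTerms_add_eq (w := fun _ => 1) (idealPreimage_grD_isHomogeneous J)]
  exact Submodule.ext fun b => SetLike.ext_iff.1 h b

end AssociatedGraded

/-! ### Dimensions of weight filtrations -/

section Dimension

variable {k P Q : Type*} [Field k] [AddCommGroup P] [Module k P] [AddCommGroup Q] [Module k Q]
  {w : ℕ+ → ℕ}

theorem finrank_map_add_finrank_inf_ker (f : P →ₗ[k] Q) (G : Submodule k P)
    [FiniteDimensional k G] :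
    Module.finrank k (G.map f) + Module.finrank k ↥(G ⊓ LinearMap.ker f) =
      Module.finrank k G := by
  have h := LinearMap.finrank_range_add_finrank_ker (f.domRestrict G)
  rwa [LinearMap.range_domRestrict, LinearMap.ker_domRestrict, ← Submodule.finrank_map_subtype_eq,
    Submodule.map_comap_subtype] at h

theorem finrank_map_sup_add_finrank_inf (f : P →ₗ[k] Q) (F G : Submodule k P)
    [FiniteDimensional k F] [FiniteDimensional k G] :
    Module.finrank k ((F ⊔ G).map f) + Module.finrank k ↥(G ⊓ (F ⊔ LinearMap.ker f)) =
      Module.finrank k (F.map f) + Module.finrank k G := by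
  have hsup := Submodule.finrank_sup_add_finrank_inf_eq (F.map f) (G.map f)
  have hG := finrank_map_add_finrank_inf_ker f G
  have hinf := finrank_map_add_finrank_inf_ker f (G ⊓ (F ⊔ LinearMap.ker f))
  rw [inf_assoc, inf_eq_right.2 (le_sup_right : LinearMap.ker f ≤ F ⊔ LinearMap.ker f),
    ← Submodule.comap_map_eq, ← Submodule.map_inf_eq_map_inf_comap, inf_comm] at hinf
  rw [Submodule.map_sup, ← Submodule.comap_map_eq]
  omega

/-- The piece of weight `≤ n` of the weight filtration on an algebra generated by the letters. -/
noncomputable def weightLE {B : Type*} [Ring B] [Algebra k B] (w : ℕ+ → ℕ)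
    (ψ : FreeAlgebra k ℕ+ →ₐ[k] B) (n : ℕ) : Submodule k B :=
  (wordSpan k w (Set.Iic n)).map ψ.toLinearMap

theorem finrank_map_wordSpan_Iio_add (hw : ∀ i : ℕ+, (i : ℕ) ≤ w i)
    (f : FreeAlgebra k ℕ+ →ₗ[k] Q) (n : ℕ) :
    Module.finrank k ((wordSpan k w (Set.Iio n)).map f) + ∑ m ∈ Finset.range n,
      Module.finrank k (leadingTerms w (LinearMap.ker f) m) =
        ∑ m ∈ Finset.range n, Module.finrank k (wordSpan k w {m}) := by
  induction n with
  | zero =>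
    have h : Set.Iio 0 = (∅ : Set ℕ) := Set.Iio_bot
    rw [h, wordSpan_empty, Submodule.map_bot, finrank_bot, Finset.sum_range_zero,
      Finset.sum_range_zero, add_zero]
  | succ n ih =>
    have := wordSpan_finite (k := k) hw (bddAbove_Iio (a := n))
    have := wordSpan_finite (k := k) hw (bddAbove_singleton (a := n))
    have h := finrank_map_sup_add_finrank_inf f (wordSpan k w (Set.Iio n)) (wordSpan k w {n})
    rw [← wordSpan_union, Set.Iio_union_right, ← Order.Iio_succ, Order.succ_eq_add_one] at h
    rw [Finset.sum_range_succ, Finset.sum_range_succ, leadingTerms]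
    omega

theorem finrank_weightLE_eq {B B' : Type*} [Ring B] [Algebra k B] [Ring B'] [Algebra k B']
    (hw : ∀ i : ℕ+, (i : ℕ) ≤ w i) {ψ : FreeAlgebra k ℕ+ →ₐ[k] B} {ψ' : FreeAlgebra k ℕ+ →ₐ[k] B'}
    (h : ∀ n, leadingTerms w (LinearMap.ker ψ.toLinearMap) n =
      leadingTerms w (LinearMap.ker ψ'.toLinearMap) n) (n : ℕ) :
    Module.finrank k (weightLE w ψ n) = Module.finrank k (weightLE w ψ' n) := by
  have hψ := finrank_map_wordSpan_Iio_add hw ψ.toLinearMap (n + 1)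
  have hψ' := finrank_map_wordSpan_Iio_add hw ψ'.toLinearMap (n + 1)
  rw [← funext h] at hψ'
  rw [weightLE, weightLE, ← Order.Iio_succ, Order.succ_eq_add_one]
  omega

end Dimension

/-! ### Gelfand–Kirillov dimensions from weight filtrations -/

section WeightFiltration

variable {k : Type*} [Field k] {B : Type*} [Ring B] [Algebra k B] {w : ℕ+ → ℕ}
  {ψ : FreeAlgebra k ℕ+ →ₐ[k] B}

theorem weightLE_le {n : ℕ} {N : Submodule k B} :
    weightLE w ψ n ≤ N ↔ ∀ l : List ℕ+, (l.map w).sum ≤ n → ψ (word k l) ∈ N :=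
  Submodule.map_le_iff_le_comap.trans wordSpan_le

theorem apply_word_mem_weightLE (l : List ℕ+) : ψ (word k l) ∈ weightLE w ψ (l.map w).sum :=
  weightLE_le.1 le_rfl l le_rfl

theorem apply_ι_mem_weightLE (i : ℕ+) : ψ (FreeAlgebra.ι k i) ∈ weightLE w ψ (w i) :=
  word_singleton (k := k) i ▸ weightLE_le.1 le_rfl [i] (List.sum_singleton (x := w i)).le

theorem weightLE_mono : Monotone (weightLE w ψ) :=
  fun _ _ h => Submodule.map_mono (wordSpan_mono (Set.Iic_subset_Iic.2 h))

theorem one_le_weightLE (n : ℕ) : 1 ≤ weightLE w ψ n :=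
  Submodule.one_le.2 (map_one ψ ▸ weightLE_le.1 le_rfl [] n.zero_le)

theorem weightLE_mul_le (m n : ℕ) : weightLE w ψ m * weightLE w ψ n ≤ weightLE w ψ (m + n) := by
  rw [weightLE, weightLE, ← Submodule.map_mul]
  exact Submodule.map_mono (wordSpan_mul_le fun a ha b hb => Set.mem_Iic.2 (add_le_add ha hb))

theorem pow_le_weightLE {V : Submodule k B} {m : ℕ} (hV : V ≤ weightLE w ψ m) (i : ℕ) :
    V ^ i ≤ weightLE w ψ (m * i) := by
  induction i with
  | zero => exact one_le_weightLE _
  | succ i ih => exact (pow_succ V i).trans_le ((mul_le_mul' ih hV).trans (weightLE_mul_le _ _))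

theorem weightLE_finite (hw : ∀ i : ℕ+, (i : ℕ) ≤ w i) (n : ℕ) :
    FiniteDimensional k (weightLE w ψ n) := by
  have := wordSpan_finite (k := k) hw (bddAbove_Iic (a := n))
  exact Module.Finite.map _ _

theorem exists_mem_weightLE (hψ : Function.Surjective ψ) (b : B) : ∃ n, b ∈ weightLE w ψ n := by
  obtain ⟨t, rfl⟩ := hψ b
  have hle : wordSpan k w Set.univ ≤ (⨆ n, weightLE w ψ n).comap ψ.toLinearMap :=
    wordSpan_le.2 fun l _ => Submodule.mem_iSup_of_mem _ (apply_word_mem_weightLE l)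
  rw [wordSpan_univ] at hle
  exact (Submodule.mem_iSup_of_directed _ weightLE_mono.directed_le).1 (hle Submodule.mem_top)

theorem weightLE_le_iSup (hw : ∀ i : ℕ+, (i : ℕ) ≤ w i) {p : ℕ → Submodule k B} (h1 : 1 ≤ p 0)
    (hmul : ∀ m n, p m * p n ≤ p (m + n))
    (hι : ∀ i : ℕ+, ∃ m ≤ (i : ℕ), ψ (FreeAlgebra.ι k i) ∈ p m) (n : ℕ) :
    weightLE w ψ n ≤ ⨆ j ∈ Finset.range (n + 1), p j := by
  have hword : ∀ l : List ℕ+, ∃ m ≤ (l.map w).sum, ψ (word k l) ∈ p m := by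
    intro l
    induction l with
    | nil => exact ⟨0, le_rfl, map_one ψ ▸ Submodule.one_le.1 h1⟩
    | cons i l ih =>
      obtain ⟨m, hm, hi⟩ := hι i
      obtain ⟨m', hm', hl⟩ := ih
      rw [word_cons, map_mul, List.map_cons, List.sum_cons]
      exact ⟨m + m', add_le_add (hm.trans (hw i)) hm', hmul _ _ (Submodule.mul_mem_mul hi hl)⟩
  refine weightLE_le.2 fun l hl => ?_
  obtain ⟨m, hm, hlm⟩ := hword l
  exact le_iSup_range p (hm.trans hl) hlm

end WeightFiltration

section Generation

variable {k : Type*} [Field k] [NeZero (2 : k)]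

/-- Every `e_n` with `n ≥ 3` is a nonzero multiple of `[e_1, e_{n-1}]` or of `[e_2, e_{n-2}]`. -/
theorem exists_mem_of_bracket_mem {M : Type*} [AddCommGroup M] [Module k M] {g : ℕ+ → M}
    {β : M → M → M}
    (hβ : ∀ i j : ℕ+, β (g i) (g j) = (((j : ℕ) : k) - ((i : ℕ) : k)) • g (i + j))
    {p : ℕ → Submodule k M} (h1 : g 1 ∈ p 1) (h2 : g 2 ∈ p 1)
    (hp : ∀ i ≤ 2, ∀ n, ∀ b ∈ p n, β (g i) b ∈ p (n + 1)) (n : ℕ+) :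
    ∃ m ≤ (n : ℕ), g n ∈ p m := by
  have step : ∀ i ≤ (2 : ℕ+), ∀ j : ℕ+, ((j : ℕ) : k) ≠ ((i : ℕ) : k) → (∃ m ≤ (j : ℕ), g j ∈ p m) →
      ∃ m ≤ ((i + j : ℕ+) : ℕ), g (i + j) ∈ p m := by
    rintro i hi j hij ⟨m, hm, hj⟩
    refine ⟨m + 1, ?_, (Submodule.smul_mem_iff _ (sub_ne_zero.2 hij)).1 (hβ i j ▸ hp i hi m _ hj)⟩
    rw [PNat.add_coe, add_comm m]
    exact add_le_add i.pos hm
  induction n using PNat.strongInductionOn with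
  | _ n ih =>
    obtain rfl | hn := eq_or_ne n 1
    · exact ⟨1, le_rfl, h1⟩
    obtain ⟨n, rfl⟩ := PNat.exists_eq_succ_of_ne_one hn
    obtain rfl | hn := eq_or_ne n 1
    · exact ⟨1, one_le_two, h2⟩
    obtain ⟨n, rfl⟩ := PNat.exists_eq_succ_of_ne_one hn
    by_cases h : ((n : ℕ) : k) = 0
    · rw [add_assoc, add_comm]
      exact step 2 le_rfl n (by simpa [h] using (NeZero.ne (2 : k)).symm)
        (ih n ((PNat.lt_add_right _ _).trans (PNat.lt_add_right _ _)))
    · rw [add_comm (n + 1)]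
      exact step 1 one_le (n + 1) (by simpa using h) (ih _ (PNat.lt_add_right _ _))

variable {B : Type*} [Ring B] [Algebra k B] {w : ℕ+ → ℕ} {ψ : FreeAlgebra k ℕ+ →ₐ[k] B}

theorem GKdim_eq_growthExponent_weightLE (hw : ∀ i : ℕ+, (i : ℕ) ≤ w i)
    (hψ : Function.Surjective ψ)
    (hcomm : ∀ i j : ℕ+, ψ (FreeAlgebra.ι k i) * ψ (FreeAlgebra.ι k j) -
      ψ (FreeAlgebra.ι k j) * ψ (FreeAlgebra.ι k i) =
        (((j : ℕ) : k) - ((i : ℕ) : k)) • ψ (FreeAlgebra.ι k (i + j))) :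
    GKdim k B = growthExponent fun n => Module.finrank k (weightLE w ψ n) := by
  set V := Submodule.span k ((fun i => ψ (FreeAlgebra.ι k i)) '' Set.Iic (2 : ℕ+))
  have hV : V.FG := Submodule.fg_span ((Set.finite_Iic 2).image _)
  have hmem : ∀ i ≤ 2, ψ (FreeAlgebra.ι k i) ∈ V := fun i hi => Submodule.subset_span ⟨i, hi, rfl⟩
  refine iSup_growthExponent_eq weightLE_mono (weightLE_finite hw) (exists_mem_weightLE hψ)
    (fun V m hVm => pow_le_weightLE hVm) hV hV.pow
    (weightLE_le_iSup hw (pow_zero V).ge (fun m n => (pow_add V m n).ge) ?_)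
  refine exists_mem_of_bracket_mem (β := fun a b => a * b - b * a) hcomm
    ((pow_one V).symm ▸ hmem 1 one_le) ((pow_one V).symm ▸ hmem 2 le_rfl)
    fun i hi n b hb => sub_mem ?_ ?_
  · exact pow_succ' V n ▸ Submodule.mul_mem_mul (hmem i hi) hb
  · exact pow_succ V n ▸ Submodule.mul_mem_mul hb (hmem i hi)

end Generation

section PoissonPowers

variable {k : Type*} [Field k] {A : Type*} [CommRing A] [Algebra k A] {w : ℕ+ → ℕ}
  {ψ : FreeAlgebra k ℕ+ →ₐ[k] A}

theorem derivation_mem_weightLE {D : Derivation k A A} {m : ℕ}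
    (hD : ∀ i, D (ψ (FreeAlgebra.ι k i)) ∈ weightLE w ψ (m + w i)) {n : ℕ} {a : A}
    (ha : a ∈ weightLE w ψ n) : D a ∈ weightLE w ψ (m + n) := by
  have hword : ∀ l : List ℕ+, D (ψ (word k l)) ∈ weightLE w ψ (m + (l.map w).sum) := by
    intro l
    induction l with
    | nil => rw [word_nil, map_one, D.map_one_eq_zero]; exact zero_mem _
    | cons i l ih =>
      rw [word_cons, map_mul, D.leibniz, smul_eq_mul, smul_eq_mul, List.map_cons, List.sum_cons]
      refine add_mem ?_ ?_
      · rw [add_left_comm]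
        exact weightLE_mul_le _ _ (Submodule.mul_mem_mul (apply_ι_mem_weightLE i) ih)
      · rw [← add_assoc, add_comm]
        exact weightLE_mul_le _ _ (Submodule.mul_mem_mul (apply_word_mem_weightLE l) (hD i))
  have hle : weightLE w ψ n ≤ (weightLE w ψ (m + n)).comap D.toLinearMap :=
    weightLE_le.2 fun l hl => weightLE_mono (Nat.add_le_add_left hl m) (hword l)
  exact hle ha

variable [PoissonAlgebra k A]

theorem pb_mem_poissonPow_succ {V : Submodule k A} {n : ℕ} {v b : A} (hv : v ∈ V)
    (hb : b ∈ poissonPow V n) : PoissonAlgebra.pb (k := k) v b ∈ poissonPow V (n + 1) :=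
  Submodule.mem_sup_right (Submodule.apply_mem_map₂ _ hv hb)

theorem le_poissonPow_one (V : Submodule k A) : V ≤ poissonPow V 1 :=
  (mul_one V).ge.trans le_sup_left

theorem poissonPow_fg {V : Submodule k A} (hV : V.FG) (n : ℕ) : (poissonPow V n).FG := by
  induction n with
  | zero => rw [poissonPow, Submodule.one_eq_span]; exact Submodule.fg_span_singleton 1
  | succ n ih => exact (hV.mul ih).sup (hV.map₂ _ ih)

theorem poissonPow_mul_le (V : Submodule k A) (m n : ℕ) :
    poissonPow V m * poissonPow V n ≤ poissonPow V (m + n) := by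
  induction m generalizing n with
  | zero => exact (one_mul _).trans_le (by rw [zero_add])
  | succ m ih =>
    rw [poissonPow, Submodule.sup_mul, Nat.succ_add, mul_assoc]
    refine sup_le ((mul_le_mul_right (ih n) V).trans le_sup_left) (Submodule.mul_le.2 ?_)
    intro a ha b hb
    have hle : Submodule.map₂ PoissonAlgebra.pb V (poissonPow V m) ≤
        (poissonPow V (m + n + 1)).comap (LinearMap.mulRight k b) := by
      refine Submodule.map₂_le.2 fun v hv c hc => ?_
      have h : PoissonAlgebra.pb (k := k) v c * b =
          PoissonAlgebra.pb (k := k) v (c * b) - c * PoissonAlgebra.pb (k := k) v b :=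
        eq_sub_of_add_eq (PoissonAlgebra.pb_mul v c b).symm
      rw [Submodule.mem_comap, LinearMap.mulRight_apply, h]
      exact sub_mem (pb_mem_poissonPow_succ hv (ih n (Submodule.mul_mem_mul hc hb)))
        (ih (n + 1) (Submodule.mul_mem_mul hc (pb_mem_poissonPow_succ hv hb)))
    exact hle ha

variable (k) in
/-- The Hamiltonian derivation `b ↦ {a, b}`. -/
noncomputable def pbDerivation (a : A) : Derivation k A A :=
  Derivation.mk' (PoissonAlgebra.pb a) fun b c => by
    rw [PoissonAlgebra.pb_mul, add_comm, mul_comm _ c, smul_eq_mul, smul_eq_mul]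

theorem map₂_pb_weightLE_le (hadd : ∀ i j, w (i + j) ≤ w i + w j)
    (hpb : ∀ i j : ℕ+, PoissonAlgebra.pb (k := k) (ψ (FreeAlgebra.ι k i)) (ψ (FreeAlgebra.ι k j)) =
      (((j : ℕ) : k) - ((i : ℕ) : k)) • ψ (FreeAlgebra.ι k (i + j))) (m n : ℕ) :
    Submodule.map₂ PoissonAlgebra.pb (weightLE w ψ m) (weightLE w ψ n) ≤ weightLE w ψ (m + n) := by
  have hgen : ∀ i j, pbDerivation k (ψ (FreeAlgebra.ι k i)) (ψ (FreeAlgebra.ι k j)) ∈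
      weightLE w ψ (w i + w j) := fun i j => by
    change PoissonAlgebra.pb (ψ _) (ψ _) ∈ _
    rw [hpb]
    exact Submodule.smul_mem _ _ (weightLE_mono (hadd i j) (apply_ι_mem_weightLE _))
  refine Submodule.map₂_le.2 fun a ha b hb =>
    derivation_mem_weightLE (D := pbDerivation k a) (fun i => ?_) hb
  change PoissonAlgebra.pb a (ψ _) ∈ _
  rw [PoissonAlgebra.pb_swap, add_comm]
  exact neg_mem (derivation_mem_weightLE (hgen i) ha)

theorem poissonPow_le_weightLE (hadd : ∀ i j, w (i + j) ≤ w i + w j)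
    (hpb : ∀ i j : ℕ+, PoissonAlgebra.pb (k := k) (ψ (FreeAlgebra.ι k i)) (ψ (FreeAlgebra.ι k j)) =
      (((j : ℕ) : k) - ((i : ℕ) : k)) • ψ (FreeAlgebra.ι k (i + j)))
    {V : Submodule k A} {m : ℕ} (hV : V ≤ weightLE w ψ m) (i : ℕ) :
    poissonPow V i ≤ weightLE w ψ (m * i) := by
  induction i with
  | zero => exact one_le_weightLE _
  | succ i ih =>
    rw [Nat.mul_succ, add_comm (m * i)]
    exact sup_le ((mul_le_mul' hV ih).trans (weightLE_mul_le _ _))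
      ((Submodule.map₂_le_map₂ hV ih).trans (map₂_pb_weightLE_le hadd hpb _ _))

theorem PGKdim_eq_growthExponent_weightLE [NeZero (2 : k)] (hw : ∀ i : ℕ+, (i : ℕ) ≤ w i)
    (hadd : ∀ i j, w (i + j) ≤ w i + w j) (hψ : Function.Surjective ψ)
    (hpb : ∀ i j : ℕ+, PoissonAlgebra.pb (k := k) (ψ (FreeAlgebra.ι k i)) (ψ (FreeAlgebra.ι k j)) =
      (((j : ℕ) : k) - ((i : ℕ) : k)) • ψ (FreeAlgebra.ι k (i + j))) :
    PGKdim k A = growthExponent fun n => Module.finrank k (weightLE w ψ n) := by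
  set V := Submodule.span k ((fun i => ψ (FreeAlgebra.ι k i)) '' Set.Iic (2 : ℕ+))
  have hV : V.FG := Submodule.fg_span ((Set.finite_Iic 2).image _)
  have hmem : ∀ i ≤ 2, ψ (FreeAlgebra.ι k i) ∈ V := fun i hi => Submodule.subset_span ⟨i, hi, rfl⟩
  refine iSup_growthExponent_eq weightLE_mono (weightLE_finite hw) (exists_mem_weightLE hψ)
    (fun V m hVm => poissonPow_le_weightLE hadd hpb hVm) hV (poissonPow_fg hV)
    (weightLE_le_iSup hw le_rfl (poissonPow_mul_le V) ?_)
  exact exists_mem_of_bracket_mem (β := fun a b => PoissonAlgebra.pb a b) hpb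
    (le_poissonPow_one V (hmem 1 one_le))
    (le_poissonPow_one V (hmem 2 le_rfl)) fun i hi n b hb => pb_mem_poissonPow_succ (hmem i hi) hb

end PoissonPowers

section Quotients

variable {k : Type*} [Field k] [NeZero (2 : k)] {w : ℕ+ → ℕ}

theorem GKdim_quotient_eq (hw : ∀ i : ℕ+, (i : ℕ) ≤ w i) (J : Ideal (UW k)) [J.IsTwoSided] :
    GKdim k (UW k ⧸ J) = growthExponent fun n =>
      Module.finrank k (weightLE w ((Ideal.Quotient.mkₐ k J).comp (evalU k)) n) :=
  GKdim_eq_growthExponent_weightLE hw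
    ((Ideal.Quotient.mkₐ_surjective k J).comp (evalU_surjective k)) fun i j => by
      simp only [AlgHom.comp_apply, evalU_ι]
      rw [← map_mul, ← map_mul, ← map_sub, UW.e_comm, map_smul]

theorem PGKdim_quotient_eq (hw : ∀ i : ℕ+, (i : ℕ) ≤ w i) (hadd : ∀ i j, w (i + j) ≤ w i + w j)
    (K : Ideal (SymW k)) [IsPoissonIdeal k K] :
    PGKdim k (SymW k ⧸ K) = growthExponent fun n =>
      Module.finrank k (weightLE w ((Ideal.Quotient.mkₐ k K).comp (evalS k)) n) :=
  PGKdim_eq_growthExponent_weightLE hw hadd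
    ((Ideal.Quotient.mkₐ_surjective k K).comp (evalS_surjective k)) fun i j => by
      simp only [AlgHom.comp_apply, evalS_ι]
      rw [← map_smul, ← SymW.pb_x]
      exact quotientBracket_mk K _ _

theorem GKdim_quotient_grD (J : Ideal (UW k)) [J.IsTwoSided] :
    GKdim k (UW k ⧸ J) = GKdim k (UW k ⧸ grD J) := by
  have hw : ∀ i : ℕ+, (i : ℕ) ≤ i := fun _ => le_rfl
  rw [GKdim_quotient_eq hw, GKdim_quotient_eq hw]
  refine congrArg growthExponent (funext (finrank_weightLE_eq hw fun n => ?_))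
  rw [ker_mkₐ_comp, ker_mkₐ_comp, leadingTerms_idealPreimage_grD]

theorem GKdim_quotient_eq_PGKdim_quotient_grO {I : Ideal (UW k)} [I.IsTwoSided]
    (hI : grO I = grDO I) : GKdim k (UW k ⧸ I) = PGKdim k (SymW k ⧸ grO I) := by
  have hw : ∀ i : ℕ+, (i : ℕ) ≤ i + 1 := fun i => Nat.le_succ i
  have hlt : ∀ i j : ℕ+, ((i + j : ℕ+) : ℕ) + 1 < (i + 1) + (j + 1) := fun i j => by
    rw [PNat.add_coe]
    omega
  rw [GKdim_quotient_eq hw, PGKdim_quotient_eq hw fun i j => (hlt i j).le]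
  refine congrArg growthExponent (funext (finrank_weightLE_eq hw fun n => ?_))
  rw [ker_mkₐ_comp, ker_mkₐ_comp, hI, grDO, leadingTerms_idealPreimage_evalS hlt]

end Quotients

theorem theorem3p15_general (k : Type*) [Field k] [NeZero (2 : k)] (J : Ideal (UW k))
    [J.IsTwoSided] : grO (grD J) = grDO (grD J) ∧
      GKdim k (UW k ⧸ J) = GKdim k (UW k ⧸ grD J) ∧
      GKdim k (UW k ⧸ grD J) = PGKdim k (SymW k ⧸ grO (grD J)) :=
  ⟨grO_grD_eq_grDO_grD J, GKdim_quotient_grD J,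
    GKdim_quotient_eq_PGKdim_quotient_grO (grO_grD_eq_grDO_grD J)⟩

theorem theorem3p15 (k : Type*) [Field k] [CharZero k] (J : Ideal (UW k)) [J.IsTwoSided] :
    grO (grD J) = grDO (grD J) ∧
      GKdim k (UW k ⧸ J) = GKdim k (UW k ⧸ grD J) ∧
      GKdim k (UW k ⧸ grD J) = PGKdim k (SymW k ⧸ grO (grD J)) :=
  theorem3p15_general k J
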